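/- Let $\mathbb S^1=\mathbb R/\mathbb Z$, let $e_k(x)=e^{2\pi i kx}$ and let $\hat u(k)=\int_{\mathbb S^1}u\,e_{-k}\,dx$. For $q\ge 0$ let $H^q$ be the Sobolev space of real functions on $\mathbb S^1$ with the norm $\|u\|_{H^q}^2=\sum_{k\in\mathbb Z}(1+k^2)^q|\hat u(k)|^2$. For $q>3/2$ let $\mathcal D^q$ be the set of all orientation-preserving diffeomorphisms $\varphi$ of $\mathbb S^1$ such that $\varphi$ and $\varphi^{-1}$ are of class $H^q$. It is a Hilbert manifold modelled on $H^q$: its charts are the local inverses of the map which sends $f\in H^q$ with $1+f_x>0$ to the diffeomorphism with the lift $x\mapsto x+f(x)$. Write $R_\varphi u=u\circ\varphi$. Let $r\ge 1$ and $q>\tfrac32+r$. Let $A$ be a Fourier multiplier of order $r$ that maps real functions to real functions, that is, $Au=\sum_{k}p(k)\hat u(k)e_k$ with $p:\mathbb Z\to\mathbb C$, $p(-k)=\overline{p(k)}$, and $|p(k)|\le C(1+k^2)^{r/2}$ for all $k\in\mathbb Z$ with a constant $C>0$. Suppose that $A$ induces an isomorphism from $H^q$ onto $H^{q-r}$ and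 that the map $$\varphi\mapsto A_\varphi=R_\varphi\circ A\circ R_{\varphi^{-1}},\qquad \mathcal D^q\to\mathcal L(H^q,H^{q-r}),$$ is well defined and smooth ($C^\infty$). For $u\in H^q$ let $$S(u)=A^{-1}\{[A,u]u_x-2(Au)u_x\},\qquad [A,u]w=A(uw)-uA(w).$$ Then the geodesic spray $$(\varphi,v)\mapsto S_\varphi(v)=(R_\varphi\circ S\circ R_{\varphi^{-1}})(v),\qquad \mathcal D^q\times H^q\to H^q,$$ is well defined and smooth. In particular, for all $\varphi\in\mathcal D^q$ and $v\in H^q$, the function $u=v\circ\varphi^{-1}$ satisfies $u\in H^q$, $u_x\in H^{q-1}$, $uu_x\in H^{q-1}$ and $[A,u]u_x-2(Au)u_x\in H^{q-r}$, so that $S(u)=A^{-1}\{\dots\}\in H^q$ and $S(u)\circ\varphi\in H^q$. -/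

import Mathlib

open scoped ContDiff

/-- The circle `ℝ / ℤ`. -/
abbrev S1 : Type := UnitAddCircle

/-- The Fourier coefficient `û(k) = ∫ u(x) exp(-2πikx) dx` of a real function on the circle. -/
noncomputable def coeff (u : S1 → ℝ) (k : ℤ) : ℂ := fourierCoeff (fun x => (u x : ℂ)) k

/-- `MemSob q u`: the function `u` is a continuous function with
`∑ (1 + k²)^q |û(k)|² < ∞`. For `q > 1/2` (the only exponents that are used) every class in the
Sobolev space `H^q` has exactly one continuous representative, so this describes `H^q`. -/
def MemSob (q : ℝ) (u : S1 → ℝ) : Prop :=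
  Continuous u ∧ Summable (fun k : ℤ => (1 + (k : ℝ) ^ 2) ^ q * ‖coeff u k‖ ^ 2)

theorem coeff_integrable {u : S1 → ℝ} (hu : Continuous u) (k : ℤ) :
    MeasureTheory.Integrable (fun x : S1 => fourier (-k) x • (u x : ℂ))
      AddCircle.haarAddCircle := by
  have h : Continuous (fun x : S1 => fourier (-k) x • (u x : ℂ)) := by
    simp only [smul_eq_mul]; fun_prop
  exact h.integrable_of_hasCompactSupport (HasCompactSupport.of_compactSpace _)

theorem coeff_add {u v : S1 → ℝ} (hu : Continuous u) (hv : Continuous v) (k : ℤ) :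
    coeff (u + v) k = coeff u k + coeff v k := by
  unfold coeff fourierCoeff
  rw [← MeasureTheory.integral_add (coeff_integrable hu k) (coeff_integrable hv k)]
  congr 1
  ext x
  simp [mul_add]

theorem coeff_smul (c : ℝ) (u : S1 → ℝ) (k : ℤ) : coeff (c • u) k = c * coeff u k := by
  unfold coeff fourierCoeff
  rw [← MeasureTheory.integral_const_mul]
  congr 1
  ext x
  simp; ring

theorem coeff_zero (k : ℤ) : coeff 0 k = 0 := by
  simp [coeff, fourierCoeff]

/-- A continuous function all of whose Fourier coefficients vanish is zero. -/
theorem eq_zero_of_coeff {u : S1 → ℝ} (hu : Continuous u) (h : ∀ k, coeff u k = 0) : u = 0 := by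
  let f : C(S1, ℂ) := ⟨fun x => (u x : ℂ), by fun_prop⟩
  have hf : ∀ k, fourierCoeff f k = 0 := h
  have hs : Summable (fourierCoeff f) := by simp [funext hf]
  ext x
  have := has_pointwise_sum_fourier_series_of_summable hs x
  simp only [hf, zero_smul] at this
  simpa [f] using this.unique hasSum_zero

theorem sobWeight_nonneg (q : ℝ) (k : ℤ) : 0 ≤ (1 + (k : ℝ) ^ 2) ^ q := by positivity

/-- `H^q` as a linear subspace of the space of functions on the circle. -/
def sobSubmodule (q : ℝ) : Submodule ℝ (S1 → ℝ) where
  carrier := {u | MemSob q u}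
  zero_mem' := ⟨continuous_zero, by simp [coeff_zero]⟩
  add_mem' := by
    rintro u v ⟨hu, su⟩ ⟨hv, sv⟩
    refine ⟨hu.add hv, Summable.of_nonneg_of_le (fun k => by positivity) (fun k => ?_)
      ((su.add sv).mul_left 2)⟩
    rw [coeff_add hu hv, ← mul_add, mul_left_comm]
    refine mul_le_mul_of_nonneg_left ?_ (sobWeight_nonneg q k)
    nlinarith [norm_add_le (coeff u k) (coeff v k), norm_nonneg (coeff u k + coeff v k),
      norm_nonneg (coeff u k), norm_nonneg (coeff v k), sq_nonneg (‖coeff u k‖ - ‖coeff v k‖)]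
  smul_mem' := by
    rintro c u ⟨hu, su⟩
    refine ⟨hu.const_smul c, (su.mul_left (c ^ 2)).congr (fun k => ?_)⟩
    rw [coeff_smul, norm_mul, mul_pow]
    simp; ring

/-- The real Sobolev space `H^q` of the circle. It is a type of its own, so that it carries the
Sobolev norm and no other norm. -/
def Sob (q : ℝ) : Type := ↥(sobSubmodule q)

namespace Sob

variable {q : ℝ}

instance : AddCommGroup (Sob q) := inferInstanceAs (AddCommGroup ↥(sobSubmodule q))
instance : Module ℝ (Sob q) := inferInstanceAs (Module ℝ ↥(sobSubmodule q))
instance : CoeFun (Sob q) (fun _ => S1 → ℝ) := ⟨fun u => Subtype.val u⟩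

/-- The weighted sequence `(1 + k²)^(q/2) û(k)` in `ℓ²`. -/
noncomputable def toL2 : Sob q →ₗ[ℝ] lp (fun _ : ℤ => ℂ) 2 where
  toFun u := ⟨fun k => (((1 + (k : ℝ) ^ 2) ^ (q / 2) : ℝ) : ℂ) * coeff u k, by
    refine memℓp_gen (u.2.2.congr (fun k => ?_))
    have h : (0 : ℝ) ≤ 1 + (k : ℝ) ^ 2 := by positivity
    rw [norm_mul, Complex.norm_real, Real.norm_of_nonneg (sobWeight_nonneg _ k)]
    simp only [ENNReal.toReal_ofNat, Real.rpow_ofNat]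
    rw [mul_pow, ← Real.rpow_mul_natCast h]
    norm_num⟩
  map_add' u v := by
    ext k
    change _ * coeff ((u : S1 → ℝ) + v) k = _ * coeff u k + _ * coeff v k
    rw [coeff_add u.2.1 v.2.1, mul_add]
  map_smul' c u := by
    ext k
    change _ * coeff (c • (u : S1 → ℝ)) k = c • (_ * coeff u k)
    rw [coeff_smul, Complex.real_smul]
    ring

theorem toL2_injective : Function.Injective (toL2 (q := q)) := by
  rw [injective_iff_map_eq_zero]
  intro u hu
  refine Subtype.ext (eq_zero_of_coeff u.2.1 (fun k => ?_))
  have h : (((1 + (k : ℝ) ^ 2) ^ (q / 2) : ℝ) : ℂ) * coeff u k = 0 :=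
    congrArg (fun a : lp (fun _ : ℤ => ℂ) 2 => a k) hu
  refine (mul_eq_zero.1 h).resolve_left ?_
  exact_mod_cast (Real.rpow_pos_of_pos (by positivity) _).ne'

noncomputable instance : NormedAddCommGroup (Sob q) :=
  NormedAddCommGroup.induced (Sob q) (lp (fun _ : ℤ => ℂ) 2) toL2 toL2_injective

noncomputable instance : NormedSpace ℝ (Sob q) :=
  NormedSpace.induced ℝ (Sob q) (lp (fun _ : ℤ => ℂ) 2) toL2

/-- The norm is the Sobolev norm `‖u‖² = ∑ (1 + k²)^q |û(k)|²`. -/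
theorem norm_sq_eq (u : Sob q) :
    ‖u‖ ^ 2 = ∑' k : ℤ, (1 + (k : ℝ) ^ 2) ^ q * ‖coeff u k‖ ^ 2 := by
  have h := lp.norm_rpow_eq_tsum (p := 2) (by norm_num) (toL2 u)
  simp only [ENNReal.toReal_ofNat, Real.rpow_ofNat] at h
  refine h.trans (tsum_congr (fun k => ?_))
  have h0 : (0 : ℝ) ≤ 1 + (k : ℝ) ^ 2 := by positivity
  change ‖(((1 + (k : ℝ) ^ 2) ^ (q / 2) : ℝ) : ℂ) * coeff u k‖ ^ 2 = _
  rw [norm_mul, Complex.norm_real, Real.norm_of_nonneg (sobWeight_nonneg _ k), mul_pow,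
    ← Real.rpow_mul_natCast h0]
  norm_num

end Sob

/-- The derivative `u_x` of a function on the circle. -/
noncomputable def dx (u : S1 → ℝ) (x : S1) : ℝ := deriv (fun t : ℝ => u (x + (t : S1))) 0

/-- The Fourier multiplier with symbol `p`: `(P u)(x) = ∑ p(k) û(k) exp(2πikx)`. When
`p(-k)` is the conjugate of `p(k)`, the sum is real and taking the real part changes nothing. -/
noncomputable def op (p : ℤ → ℂ) (u : S1 → ℝ) (x : S1) : ℝ :=
  (∑' k : ℤ, p k * coeff u k * fourier k x).re

/-- The symbol `p` has order `r`. -/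
def HasOrder (p : ℤ → ℂ) (r : ℝ) : Prop :=
  ∃ C > 0, ∀ k : ℤ, ‖p k‖ ≤ C * (1 + (k : ℝ) ^ 2) ^ (r / 2)

/-- The commutator `[P, u] w = P (u w) - u (P w)`. -/
noncomputable def opCommutator (p : ℤ → ℂ) (u w : S1 → ℝ) : S1 → ℝ := op p (u * w) - u * op p w

/-- The quadratic expression `[A, u] u_x - 2 (A u) u_x`, where `A` has the symbol `p`; it is the
argument of `A⁻¹` in the definition of `S u`. -/
noncomputable def quadTerm (p : ℤ → ℂ) (u : S1 → ℝ) : S1 → ℝ :=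
  opCommutator p u (dx u) - 2 * op p u * dx u

/-- The homeomorphism `φ` of the circle lifts to `x ↦ x + f x` with `f` periodic of class `H^q`
and `1 + f_x > 0`. For `q > 3/2` (where `f` is of class `C¹`) this says that `φ` is an orientation
preserving map of class `H^q` without critical points. -/
def IsSobLift {q : ℝ} (φ : S1 ≃ₜ S1) (f : Sob q) : Prop :=
  (∀ x : ℝ, φ (x : S1) = ((x + f (x : S1) : ℝ) : S1)) ∧ ∀ x : S1, 0 < 1 + dx f x

/-- The group `D^q`, for `q > 3/2`: the orientation preserving diffeomorphisms `φ` of the circle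
such that both `φ` and `φ⁻¹` are of class `H^q`. -/
structure SobDiff (q : ℝ) where
  toHomeo : S1 ≃ₜ S1
  mem : ∃ f : Sob q, IsSobLift toHomeo f
  mem_symm : ∃ g : Sob q, IsSobLift toHomeo.symm g

namespace SobDiff

variable {q : ℝ}

theorem isSobLift_refl : IsSobLift (Homeomorph.refl S1) (0 : Sob q) := by
  have h : ((0 : Sob q) : S1 → ℝ) = 0 := rfl
  refine ⟨fun x => by simp [h], fun x => by simp [h, dx]⟩

/-- The identity of the circle. -/
def one : SobDiff q :=
  ⟨Homeomorph.refl S1, ⟨0, isSobLift_refl⟩, ⟨0, isSobLift_refl⟩⟩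

/-- The set of all `f` in `H^q` for which `x ↦ x + f x` is a lift of an element of `D^q`; for
`q > 3/2` it is the open set `{f | 1 + f_x > 0}`. -/
def lifts (q : ℝ) : Set (Sob q) := {f | ∃ φ : SobDiff q, IsSobLift φ.toHomeo f}

open Classical in
/-- The element of `D^q` with the lift `x ↦ x + f x`, for `f` in `lifts q`. The map
`ofLift : lifts q → D^q` is the covering `f ↦ f + ℤ`, and its local inverses are the charts of the
Hilbert manifold `D^q`. -/
noncomputable def ofLift (f : Sob q) : SobDiff q :=
  if h : f ∈ lifts q then h.choose else one

/-- Smoothness of a map from the Hilbert manifold `D^q` to a normed space, read in the charts. -/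
def Smooth {E : Type*} [NormedAddCommGroup E] [NormedSpace ℝ E] (F : SobDiff q → E) : Prop :=
  ContDiffOn ℝ ∞ (fun f : Sob q => F (ofLift f)) (lifts q)

/-- Smoothness of a map from the Hilbert manifold `D^q × H^q` to a normed space, read in the
charts. -/
def SmoothProd {E : Type*} [NormedAddCommGroup E] [NormedSpace ℝ E]
    (F : SobDiff q → Sob q → E) : Prop :=
  ContDiffOn ℝ ∞ (fun y : Sob q × Sob q => F (ofLift y.1) y.2) (lifts q ×ˢ Set.univ)

/-- Right translation `R_φ u = u ∘ φ`. -/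
def R (φ : SobDiff q) (u : S1 → ℝ) : S1 → ℝ := u ∘ φ.toHomeo

/-- Right translation by the inverse, `R_{φ⁻¹} u = u ∘ φ⁻¹`. -/
def Rinv (φ : SobDiff q) (u : S1 → ℝ) : S1 → ℝ := u ∘ φ.toHomeo.symm

end SobDiff

/-! The point is that the commutator is already contained in the smooth map `φ ↦ A_φ`. Let `φ_t`
have the lift `x + f + t v`, and put `u = v ∘ φ⁻¹`. Differentiating `A_{φ_t} v` at `t = 0` gives
`-R_φ([A,u] u_x)`. By the chain rule `R_φ u_x = v_x / (1 + f_x)`. Hence `R_φ([A,u] u_x - 2 (Au) u_x)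
= -Q(f, v)`, where `Q = (dA_φ · v) v + 2 (A_φ v) (v_x / (1 + f_x))`, and `S_φ(v) = -A_φ⁻¹ Q`. Every
ingredient is smooth: a derivative of a smooth map, products in the algebra `H^{q-r}`, and inversion
of bounded operators between complete spaces. This also gives the gain of regularity: `Q` takes
values in `H^{q-r}`, although `A(u u_x)` and `u A u_x` separately are only controlled in
`H^{q-r-1}`.

The derivative formula (`Rinv_fderiv_conj_apply`) is proved one Fourier coefficient at a time. The
substitution `y = φ_t(x)` turns a coefficient of `w ∘ φ_t⁻¹` into an integral that depends on `t`
only through `w`, an exponential and an affine Jacobian, so the inverse diffeomorphism is never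
differentiated.

The supporting analysis is that `H^s` is an algebra for `s > 1/2` (`sobE_mul_le`), that it is stable
under composition with elements of `D^q` for `1/2 < s ≤ q` (`MemSob.comp`, by interpolation between
`L²` and `H²` and then induction on derivatives), and that `1 + f_x > 0` alone characterises the
lifts (`mem_lifts_iff`). Composition is only required to preserve `H^s`, not to be bounded: the open
mapping theorem supplies the continuity of `A_φ⁻¹`. -/

open MeasureTheory Set Filter Topology
open scoped ENNReal

/-! ### Calculus and integration on the circle. -/

/-- The normalised Haar measure of the circle. -/
noncomputable abbrev haar : Measure S1 := AddCircle.haarAddCircle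

theorem integrable_haar {E : Type*} [NormedAddCommGroup E] {F : S1 → E} (hF : Continuous F) :
    Integrable F haar :=
  hF.integrable_of_hasCompactSupport (HasCompactSupport.of_compactSpace _)

theorem integral_haar_eq {E : Type*} [NormedAddCommGroup E] [NormedSpace ℝ E] (a : ℝ)
    (F : S1 → E) :
    ∫ x, F x ∂haar = ∫ t in a..a + 1, F (t : S1) := by
  rw [UnitAddCircle.intervalIntegral_preimage a F, haar, AddCircle.integral_haarAddCircle]
  simp

theorem continuous_of_lift {E : Type*} [TopologicalSpace E] {F : S1 → E}
    (h : Continuous (fun t : ℝ => F (t : S1))) : Continuous F :=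
  (QuotientAddGroup.isQuotientMap_mk (N := AddSubgroup.zmultiples (1 : ℝ))).continuous_iff.2 h

theorem continuous_lift {E : Type*} [TopologicalSpace E] {F : S1 → E} (h : Continuous F) :
    Continuous (fun t : ℝ => F (t : S1)) :=
  h.comp (AddCircle.continuous_mk' 1)

/-- `u'` is the derivative of the function `u` on the circle. -/
def HasDx {E : Type*} [NormedAddCommGroup E] [NormedSpace ℝ E] (u u' : S1 → E) : Prop :=
  ∀ x : ℝ, HasDerivAt (fun t : ℝ => u (t : S1)) (u' (x : S1)) x

namespace HasDx

theorem continuous {E : Type*} [NormedAddCommGroup E] [NormedSpace ℝ E] {u u' : S1 → E}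
    (h : HasDx u u') : Continuous u :=
  continuous_of_lift (continuous_iff_continuousAt.2 fun x => (h x).continuousAt)

theorem add {E : Type*} [NormedAddCommGroup E] [NormedSpace ℝ E] {u u' v v' : S1 → E}
    (hu : HasDx u u') (hv : HasDx v v') : HasDx (u + v) (u' + v') :=
  fun x => (hu x).add (hv x)

theorem const {E : Type*} [NormedAddCommGroup E] [NormedSpace ℝ E] (c : E) :
    HasDx (fun _ : S1 => c) 0 :=
  fun x => hasDerivAt_const x c

theorem mul {𝔸 : Type*} [NormedRing 𝔸] [NormedAlgebra ℝ 𝔸] {u u' v v' : S1 → 𝔸}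
    (hu : HasDx u u') (hv : HasDx v v') : HasDx (u * v) (u' * v + u * v') :=
  fun x => (hu x).mul (hv x)

theorem ofReal {u u' : S1 → ℝ} (hu : HasDx u u') :
    HasDx (fun x => (u x : ℂ)) (fun x => (u' x : ℂ)) :=
  fun x => (hu x).ofReal_comp

theorem re {u u' : S1 → ℂ} (hu : HasDx u u') :
    HasDx (fun x => (u x).re) (fun x => (u' x).re) :=
  fun x => Complex.reCLM.hasFDerivAt.comp_hasDerivAt x (hu x)

theorem inv {u u' : S1 → ℝ} (hu : HasDx u u') (h : ∀ x, u x ≠ 0) :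
    HasDx (fun x => (u x)⁻¹) (fun x => -u' x / u x ^ 2) :=
  fun x => (hu x).fun_inv (h x)

theorem dx_eq {u u' : S1 → ℝ} (hu : HasDx u u') : dx u = u' := by
  ext x
  induction x using QuotientAddGroup.induction_on with
  | H x =>
    have h1 : HasDerivAt (fun t : ℝ => u ((x + t : ℝ) : S1)) (u' (x : S1)) 0 := by
      have := hu (x + 0)
      rw [add_zero] at this
      exact HasDerivAt.comp_const_add x 0 (by simpa using hu x)
    have h2 := h1.deriv
    simpa [dx, AddCircle.coe_add] using h2

end HasDx

theorem hasDx_fourier (k : ℤ) :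
    HasDx (fun x : S1 => fourier k x)
      (fun x => 2 * Real.pi * Complex.I * k * fourier k x) := by
  intro x
  simpa using hasDerivAt_fourier 1 k x

theorem integral_eq_zero_of_hasDx {F F' : S1 → ℂ} (h : HasDx F F') (hc : Continuous F') :
    ∫ x, F' x ∂haar = 0 := by
  rw [integral_haar_eq 0, intervalIntegral.integral_eq_sub_of_hasDerivAt (fun x _ => h x)
    ((continuous_lift hc).intervalIntegrable _ _)]
  have : ((1 : ℝ) : S1) = ((0 : ℝ) : S1) := by simp
  simp [this]

/-! ### Fourier coefficients and synthesis of Fourier series. -/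

theorem coeff_eq (u : S1 → ℝ) (k : ℤ) : coeff u k = ∫ x, fourier (-k) x * (u x : ℂ) ∂haar := rfl

theorem coeff_of_hasDx {u u' : S1 → ℝ} (h : HasDx u u') (hc : Continuous u') (k : ℤ) :
    coeff u' k = 2 * Real.pi * Complex.I * k * coeff u k := by
  have h1 := (hasDx_fourier (-k)).mul h.ofReal
  have hu := h.continuous
  have h2 := integral_eq_zero_of_hasDx h1 (by fun_prop)
  have h3 : ∫ x : S1, (-(2 * Real.pi * Complex.I * k) * (fourier (-k) x * (u x : ℂ))
      + fourier (-k) x * (u' x : ℂ)) ∂haar = 0 := by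
    rw [← h2]
    refine integral_congr_ae (Eventually.of_forall fun x => ?_)
    simp only [Pi.add_apply, Pi.mul_apply]
    push_cast
    ring
  rw [integral_add (integrable_haar (by fun_prop)) (integrable_haar (by fun_prop)),
    integral_const_mul] at h3
  rw [coeff_eq, coeff_eq]
  linear_combination h3

/-- Integration over the circle, as a continuous linear functional. -/
noncomputable def intCLM : C(S1, ℂ) →L[ℂ] ℂ :=
  LinearMap.mkContinuous
    { toFun := fun F => ∫ x, F x ∂haar
      map_add' := fun F G => integral_add (integrable_haar F.continuous)
        (integrable_haar G.continuous)
      map_smul' := fun c F => integral_const_mul c _ } 1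
    (fun F => by
      have := norm_integral_le_of_norm_le_const (μ := haar)
        (Eventually.of_forall fun x => F.norm_coe_le_norm x)
      simpa using this)

theorem intCLM_apply (F : C(S1, ℂ)) : intCLM F = ∫ x, F x ∂haar := rfl

theorem hasSum_coeff {u : S1 → ℝ} (hu : Continuous u) (h : Summable fun k => ‖coeff u k‖)
    (x : S1) : HasSum (fun k => coeff u k * fourier k x) (u x : ℂ) := by
  let f : C(S1, ℂ) := ⟨fun x => (u x : ℂ), by fun_prop⟩
  exact has_pointwise_sum_fourier_series_of_summable (f := f) h.of_norm x

theorem hasSum_coeff_continuousMap {u : S1 → ℝ} (hu : Continuous u)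
    (h : Summable fun k => ‖coeff u k‖) :
    HasSum (fun k => coeff u k • fourier k) (⟨fun x => (u x : ℂ), by fun_prop⟩ : C(S1, ℂ)) :=
  hasSum_fourier_series_of_summable (f := ⟨fun x => (u x : ℂ), by fun_prop⟩) h.of_norm

theorem coeff_neg (u : S1 → ℝ) (k : ℤ) : coeff u (-k) = (starRingEnd ℂ) (coeff u k) := by
  rw [coeff_eq, coeff_eq, ← integral_conj]
  simp

theorem coeff_ext {u v : S1 → ℝ} (hu : Continuous u) (hv : Continuous v)
    (h : ∀ k, coeff u k = coeff v k) : u = v := by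
  have h1 : u - v = 0 := by
    refine eq_zero_of_coeff (hu.sub hv) fun k => ?_
    have : u - v = u + (-1 : ℝ) • v := by ext x; simp; ring
    rw [this, coeff_add hu (hv.const_smul _), coeff_smul, h]
    simp
  exact sub_eq_zero.1 h1

/-- The real part of the Fourier series with the coefficients `c`. -/
noncomputable def synth (c : ℤ → ℂ) (x : S1) : ℝ := (∑' k : ℤ, c k * fourier k x).re

theorem summable_smul_fourier {c : ℤ → ℂ} (hc : Summable fun k => ‖c k‖) :
    Summable (fun k => c k • (fourier k : C(S1, ℂ))) := by
  refine Summable.of_norm (hc.congr fun k => ?_)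
  rw [norm_smul, fourier_norm, mul_one]

theorem synthC_apply {c : ℤ → ℂ} (hc : Summable fun k => ‖c k‖) (x : S1) :
    (∑' k, c k • (fourier k : C(S1, ℂ))) x = ∑' k, c k * fourier k x := by
  have := (ContinuousMap.evalCLM ℂ x).map_tsum (summable_smul_fourier hc)
  simpa using this

theorem continuous_synth {c : ℤ → ℂ} (hc : Summable fun k => ‖c k‖) :
    Continuous (synth c) := by
  have h : synth c = fun x => ((∑' k, c k • (fourier k : C(S1, ℂ))) x).re := by
    ext x
    rw [synthC_apply hc, synth]
  rw [h]
  exact Complex.continuous_re.comp (ContinuousMap.continuous _)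

theorem ofReal_synth {c : ℤ → ℂ} (hs : ∀ k, c (-k) = (starRingEnd ℂ) (c k)) (x : S1) :
    (synth c x : ℂ) = ∑' k : ℤ, c k * fourier k x := by
  rw [synth]
  apply Complex.conj_eq_iff_re.1
  rw [Complex.conj_tsum, ← (Equiv.neg ℤ).tsum_eq]
  refine tsum_congr fun k => ?_
  simp [hs]

/-- Absolute summability gives uniform convergence, hence termwise integration; the conjugate
symmetry makes the real part in `synth` harmless. -/
theorem coeff_synth {c : ℤ → ℂ} (hc : Summable fun k => ‖c k‖)
    (hs : ∀ k, c (-k) = (starRingEnd ℂ) (c k)) (k : ℤ) :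
    coeff (synth c) k = c k := by
  have h1 : coeff (synth c) k = intCLM (fourier (-k) * ∑' n, c n • (fourier n : C(S1, ℂ))) := by
    rw [coeff_eq, intCLM_apply]
    refine integral_congr_ae (Eventually.of_forall fun x => ?_)
    simp only [ContinuousMap.mul_apply]
    rw [ofReal_synth hs, synthC_apply hc]
  rw [h1, ← (summable_smul_fourier hc).tsum_mul_left,
    intCLM.map_tsum ((summable_smul_fourier hc).mul_left _)]
  have h2 : ∀ n, intCLM (fourier (-k) * c n • (fourier n : C(S1, ℂ)))
      = c n * (Pi.single n 1 : ℤ → ℂ) k := by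
    intro n
    rw [mul_smul_comm, map_smul, ← fourierCoeff_fourier (T := 1)]
    rfl
  simp_rw [h2]
  rw [tsum_eq_single k (fun n hn => by simp [hn.symm])]
  simp

theorem hasDx_synth {c : ℤ → ℂ} (hc : Summable fun k => ‖c k‖)
    (hc1 : Summable fun k : ℤ => ‖2 * Real.pi * Complex.I * k * c k‖) :
    HasDx (synth c) (synth fun k => 2 * Real.pi * Complex.I * k * c k) := by
  refine HasDx.re (u := fun x => ∑' k : ℤ, c k * fourier k x)
    (u' := fun x => ∑' k : ℤ, 2 * Real.pi * Complex.I * k * c k * fourier k x) fun x => ?_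
  have hn : ∀ (k : ℤ) (y : S1), ‖(fourier k y : ℂ)‖ = 1 := fun k y => Circle.norm_coe _
  refine hasDerivAt_tsum (g := fun (k : ℤ) (y : ℝ) => c k * fourier k (y : S1))
    (g' := fun (k : ℤ) (y : ℝ) => 2 * Real.pi * Complex.I * k * c k * fourier k (y : S1))
    hc1 (fun k y => ?_) (fun k y => ?_) (y₀ := 0) ?_ x
  · have := (hasDx_fourier k y).const_mul (c k)
    convert! this using 1
    ring
  · rw [norm_mul _ (fourier k _), hn, mul_one]
  · refine Summable.of_norm (hc.congr fun k => ?_)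
    rw [norm_mul, hn, mul_one]

theorem synth_coeff {u : S1 → ℝ} (hu : Continuous u) (h : Summable fun k => ‖coeff u k‖) :
    synth (coeff u) = u :=
  coeff_ext (continuous_synth h) hu (coeff_synth h (coeff_neg u))

/-! ### The Sobolev scale and differentiation. -/

/-- The square of the Sobolev norm, with values in `[0, ∞]`. -/
noncomputable def sobE (s : ℝ) (u : S1 → ℝ) : ℝ≥0∞ :=
  ∑' k : ℤ, ENNReal.ofReal ((1 + (k : ℝ) ^ 2) ^ s) * ‖coeff u k‖ₑ ^ 2

theorem ofReal_sobTerm (s : ℝ) (u : S1 → ℝ) (k : ℤ) :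
    ENNReal.ofReal ((1 + (k : ℝ) ^ 2) ^ s * ‖coeff u k‖ ^ 2) =
      ENNReal.ofReal ((1 + (k : ℝ) ^ 2) ^ s) * ‖coeff u k‖ₑ ^ 2 := by
  rw [ENNReal.ofReal_mul (sobWeight_nonneg s k), ENNReal.ofReal_pow (norm_nonneg _),
    ofReal_norm]

/-- With values in `[0, ∞]`, estimates can be proved before any summability is known; membership
then follows from finiteness. -/
theorem memSob_iff {s : ℝ} {u : S1 → ℝ} : MemSob s u ↔ Continuous u ∧ sobE s u ≠ ⊤ := by
  refine and_congr_right fun _ => ?_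
  have h : sobE s u = ∑' k : ℤ, ENNReal.ofReal ((1 + (k : ℝ) ^ 2) ^ s * ‖coeff u k‖ ^ 2) :=
    tsum_congr fun k => (ofReal_sobTerm s u k).symm
  rw [h]
  refine ⟨fun h => h.tsum_ofReal_ne_top, fun h => ?_⟩
  have := ENNReal.summable_toReal h
  refine this.congr fun k => ENNReal.toReal_ofReal (by positivity)

theorem Sob.ofReal_norm_sq {s : ℝ} (u : Sob s) : ENNReal.ofReal (‖u‖ ^ 2) = sobE s u := by
  rw [Sob.norm_sq_eq, ENNReal.ofReal_tsum_of_nonneg (fun k => by positivity) u.2.2]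
  exact tsum_congr fun k => ofReal_sobTerm s u k

theorem sobE_mono {s t : ℝ} (h : s ≤ t) (u : S1 → ℝ) : sobE s u ≤ sobE t u := by
  refine ENNReal.tsum_le_tsum fun k => ?_
  gcongr
  nlinarith [sq_nonneg (k : ℝ)]

theorem MemSob.mono {s t : ℝ} {u : S1 → ℝ} (h : s ≤ t) (hu : MemSob t u) : MemSob s u := by
  rw [memSob_iff] at *
  exact ⟨hu.1, ne_top_of_le_ne_top hu.2 (sobE_mono h u)⟩

theorem sobE_zero {u : S1 → ℝ} (hu : Continuous u) :
    sobE 0 u = ENNReal.ofReal (∫ x, u x ^ 2 ∂haar) := by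
  let f : C(S1, ℂ) := ⟨fun x => (u x : ℂ), by fun_prop⟩
  have h := hasSum_sq_fourierCoeff (ContinuousMap.toLp (E := ℂ) 2 haar ℂ f)
  simp_rw [fourierCoeff_toLp] at h
  have h1 : ∀ k, fourierCoeff f k = coeff u k := fun k => rfl
  simp_rw [h1] at h
  have h2 : ∫ t, ‖(ContinuousMap.toLp (E := ℂ) 2 haar ℂ f) t‖ ^ 2 ∂haar
      = ∫ t, u t ^ 2 ∂haar := by
    refine integral_congr_ae ?_
    filter_upwards [ContinuousMap.coeFn_toLp haar (𝕜 := ℂ) (p := 2) f] with x hx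
    rw [hx]
    simp [f]
  rw [h2] at h
  have h3 : sobE 0 u = ∑' k, ENNReal.ofReal (‖coeff u k‖ ^ 2) := by
    refine tsum_congr fun k => ?_
    simp [ENNReal.ofReal_pow]
  rw [h3, ← ENNReal.ofReal_tsum_of_nonneg (fun k => by positivity) h.summable, h.tsum_eq]

theorem sobE_zero_ne_top {u : S1 → ℝ} (hu : Continuous u) : sobE 0 u ≠ ⊤ := by
  rw [sobE_zero hu]
  exact ENNReal.ofReal_ne_top

theorem memSob_zero {u : S1 → ℝ} (hu : Continuous u) : MemSob 0 u :=
  memSob_iff.2 ⟨hu, sobE_zero_ne_top hu⟩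

theorem memSob_of_hasDx {s : ℝ} {u u' : S1 → ℝ} (h : HasDx u u') (hu' : MemSob (s - 1) u') :
    MemSob s u := by
  refine ⟨h.continuous, ?_⟩
  -- The derivative does not see the mode `k = 0`, so its term is added by hand; for `k ≠ 0` one has
  -- `1 + k² ≤ 2 (2πk)²`.
  refine Summable.of_nonneg_of_le (fun k => by positivity) (fun k => ?_)
    ((hu'.2.mul_left 2).add (summable_of_ne_finset_zero (s := {0})
      (f := fun k : ℤ => if k = 0 then ‖coeff u 0‖ ^ 2 else 0) (fun k hk => if_neg (by simpa using hk))))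
  rcases eq_or_ne k 0 with rfl | hk
  · have : 0 ≤ ‖coeff u' 0‖ ^ 2 := by positivity
    simp
  · simp only [hk, if_false, add_zero]
    rw [coeff_of_hasDx h hu'.1]
    have hk1 : (1 : ℝ) ≤ (k : ℝ) ^ 2 := by
      have : (1 : ℤ) ≤ k ^ 2 := Int.one_le_abs hk |>.trans' le_rfl |> fun h => by
        rw [← sq_abs]; nlinarith
      exact_mod_cast this
    have hpos : (0 : ℝ) < 1 + (k : ℝ) ^ 2 := by positivity
    rw [Real.rpow_sub_one hpos.ne']
    have hn : ‖2 * (Real.pi : ℂ) * Complex.I * k * coeff u k‖ ^ 2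
        = (2 * Real.pi) ^ 2 * (k : ℝ) ^ 2 * ‖coeff u k‖ ^ 2 := by
      simp only [norm_mul, Complex.norm_I, Complex.norm_real, mul_pow, Complex.norm_intCast,
        sq_abs, Real.norm_eq_abs, Complex.norm_ofNat]
      ring
    rw [hn]
    have hw : 0 ≤ (1 + (k : ℝ) ^ 2) ^ s * ‖coeff u k‖ ^ 2 := by positivity
    have hpi : (1 : ℝ) ≤ (2 * Real.pi) ^ 2 := by nlinarith [Real.pi_gt_three]
    have e : 2 * ((1 + (k : ℝ) ^ 2) ^ s / (1 + (k : ℝ) ^ 2)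
        * ((2 * Real.pi) ^ 2 * (k : ℝ) ^ 2 * ‖coeff u k‖ ^ 2))
        = ((1 + (k : ℝ) ^ 2) ^ s * ‖coeff u k‖ ^ 2)
          * (2 * ((2 * Real.pi) ^ 2 * (k : ℝ) ^ 2) / (1 + (k : ℝ) ^ 2)) := by ring
    rw [e]
    refine le_mul_of_one_le_right hw ?_
    rw [le_div_iff₀ hpos]
    nlinarith

theorem sobE_deriv_le {s : ℝ} {u u' : S1 → ℝ} (h : HasDx u u') (hc : Continuous u') :
    sobE (s - 1) u' ≤ ENNReal.ofReal ((2 * Real.pi) ^ 2) * sobE s u := by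
  rw [sobE, sobE, ← ENNReal.tsum_mul_left]
  refine ENNReal.tsum_le_tsum fun k => ?_
  rw [← ofReal_sobTerm, ← ofReal_sobTerm, ← ENNReal.ofReal_mul (by positivity)]
  refine ENNReal.ofReal_le_ofReal ?_
  rw [coeff_of_hasDx h hc]
  have hpos : (0 : ℝ) < 1 + (k : ℝ) ^ 2 := by positivity
  rw [Real.rpow_sub_one hpos.ne']
  have hn : ‖2 * (Real.pi : ℂ) * Complex.I * k * coeff u k‖ ^ 2
      = (2 * Real.pi) ^ 2 * (k : ℝ) ^ 2 * ‖coeff u k‖ ^ 2 := by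
    simp only [norm_mul, Complex.norm_I, Complex.norm_real, mul_pow, Complex.norm_intCast,
      sq_abs, Real.norm_eq_abs, Complex.norm_ofNat]
    ring
  rw [hn]
  have e : (1 + (k : ℝ) ^ 2) ^ s / (1 + (k : ℝ) ^ 2)
        * ((2 * Real.pi) ^ 2 * (k : ℝ) ^ 2 * ‖coeff u k‖ ^ 2)
      = ((2 * Real.pi) ^ 2 * ((1 + (k : ℝ) ^ 2) ^ s * ‖coeff u k‖ ^ 2))
          * ((k : ℝ) ^ 2 / (1 + (k : ℝ) ^ 2)) := by ring
  rw [e]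
  refine mul_le_of_le_one_right (by positivity) ?_
  rw [div_le_one hpos]
  linarith

theorem memSob_deriv {s : ℝ} {u u' : S1 → ℝ} (h : HasDx u u') (hc : Continuous u')
    (hu : MemSob s u) : MemSob (s - 1) u' :=
  memSob_iff.2 ⟨hc, ne_top_of_le_ne_top
    (ENNReal.mul_ne_top ENNReal.ofReal_ne_top (memSob_iff.1 hu).2) (sobE_deriv_le h hc)⟩

theorem memSob_const (s c : ℝ) : MemSob s (fun _ => c) := by
  refine ⟨continuous_const, summable_of_ne_finset_zero (s := {0}) fun k hk => ?_⟩
  have h := coeff_of_hasDx (HasDx.const c) continuous_const k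
  have hk' : (k : ℂ) ≠ 0 := by simpa using hk
  have h0 : coeff (0 : S1 → ℝ) k = 0 := coeff_zero k
  rw [h0, eq_comm, mul_eq_zero] at h
  have : coeff (fun _ => c) k = 0 := h.resolve_left (by
    simp [hk', Real.pi_ne_zero])
  simp [this]

/-! ### Embedding into the Wiener algebra and the product estimate. -/

theorem ENNReal.tsum_mul_sq_le {ι : Type*} (f g : ι → ℝ≥0∞) :
    (∑' i, f i * g i) ^ 2 ≤ (∑' i, f i ^ 2) * ∑' i, g i ^ 2 := by
  let _ : MeasurableSpace ι := ⊤
  have h := ENNReal.lintegral_mul_le_Lp_mul_Lq (Measure.count : Measure ι)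
    Real.HolderConjugate.two_two (f := f) (g := g) measurable_from_top.aemeasurable
    measurable_from_top.aemeasurable
  simp only [lintegral_count' measurable_from_top, Pi.mul_apply] at h
  have h2 := pow_le_pow_left' h 2
  refine h2.trans (le_of_eq ?_)
  rw [mul_pow, ← ENNReal.rpow_mul_natCast, ← ENNReal.rpow_mul_natCast]
  norm_num

/-- Young's inequality `ℓ² * ℓ¹ ⊂ ℓ²`: Cauchy–Schwarz applied to `(a c^{1/2}) · c^{1/2}`, followed
by an exchange of sums. -/
theorem ENNReal.tsum_convolution_sq_le (a c : ℤ → ℝ≥0∞) :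
    ∑' k, (∑' l, a l * c (k - l)) ^ 2 ≤ (∑' k, a k ^ 2) * (∑' k, c k) ^ 2 := by
  have hsq : ∀ x : ℝ≥0∞, (x ^ (1 / 2 : ℝ)) * (x ^ (1 / 2 : ℝ)) = x := fun x => by
    rw [← ENNReal.rpow_add_of_nonneg _ _ (by norm_num) (by norm_num)]
    norm_num
  have h1 : ∀ k, (∑' l, a l * c (k - l)) ^ 2 ≤ (∑' l, a l ^ 2 * c (k - l)) * ∑' l, c l := by
    intro k
    have h := ENNReal.tsum_mul_sq_le (fun l => a l * c (k - l) ^ (1 / 2 : ℝ))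
      (fun l => c (k - l) ^ (1 / 2 : ℝ))
    simp only [mul_assoc, hsq] at h
    refine h.trans (le_of_eq ?_)
    congr 1
    · refine tsum_congr fun l => ?_
      rw [mul_pow, sq (c (k - l) ^ (1 / 2 : ℝ)), hsq]
    · simp only [sq, hsq]
      exact (Equiv.subLeft k).tsum_eq c
  refine (ENNReal.tsum_le_tsum h1).trans (le_of_eq ?_)
  rw [ENNReal.tsum_mul_right, ENNReal.tsum_comm]
  have h2 : ∀ l, ∑' k, a l ^ 2 * c (k - l) = a l ^ 2 * ∑' k, c k := fun l => by
    rw [ENNReal.tsum_mul_left]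
    congr 1
    exact (Equiv.subRight l).tsum_eq c
  simp_rw [h2]
  rw [ENNReal.tsum_mul_right]
  ring

/-- The constant of the embedding of `H^s` into the Wiener algebra. -/
noncomputable def embConst (s : ℝ) : ℝ≥0∞ := ∑' k : ℤ, ENNReal.ofReal ((1 + (k : ℝ) ^ 2) ^ (-s))

theorem embConst_ne_top {s : ℝ} (hs : 1 / 2 < s) : embConst s ≠ ⊤ := by
  refine Summable.tsum_ofReal_ne_top ?_
  refine Summable.of_nonneg_of_le (fun k => by positivity) (fun k => ?_)
    ((Real.summable_abs_int_rpow (b := 2 * s) (by linarith)).add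
      (summable_of_ne_finset_zero (s := {0})
      (f := fun k : ℤ => if k = 0 then (1 : ℝ) else 0) (fun k hk => if_neg (by simpa using hk))))
  rcases eq_or_ne k 0 with rfl | hk
  · have : (0 : ℝ) ≤ |((0 : ℤ) : ℝ)| ^ (-(2 * s)) := by positivity
    simp [Real.rpow_nonneg]
  · simp only [hk, if_false, add_zero]
    have hpos : 0 < |(k : ℝ)| := by positivity
    have e : |(k : ℝ)| ^ (-(2 * s)) = ((k : ℝ) ^ 2) ^ (-s) := by
      rw [← sq_abs, ← Real.rpow_natCast_mul hpos.le]
      congr 1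
      push_cast
      ring
    rw [e]
    exact Real.rpow_le_rpow_of_nonpos (by positivity) (by linarith) (by linarith)

theorem ofReal_weight_sq (s : ℝ) (k : ℤ) : ENNReal.ofReal ((1 + (k : ℝ) ^ 2) ^ (s / 2)) ^ 2
    = ENNReal.ofReal ((1 + (k : ℝ) ^ 2) ^ s) := by
  rw [← ENNReal.ofReal_pow (sobWeight_nonneg _ k), ← Real.rpow_mul_natCast (by positivity)]
  norm_num

theorem sobE_eq_tsum_sq (s : ℝ) (u : S1 → ℝ) :
    sobE s u = ∑' k : ℤ, (ENNReal.ofReal ((1 + (k : ℝ) ^ 2) ^ (s / 2)) * ‖coeff u k‖ₑ) ^ 2 :=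
  tsum_congr fun k => by rw [mul_pow, ofReal_weight_sq]

theorem tsum_enorm_coeff_sq_le (s : ℝ) (u : S1 → ℝ) :
    (∑' k, ‖coeff u k‖ₑ) ^ 2 ≤ embConst s * sobE s u := by
  have h := ENNReal.tsum_mul_sq_le (fun k : ℤ => ENNReal.ofReal ((1 + (k : ℝ) ^ 2) ^ (-s / 2)))
    (fun k : ℤ => ENNReal.ofReal ((1 + (k : ℝ) ^ 2) ^ (s / 2)) * ‖coeff u k‖ₑ)
  rw [← sobE_eq_tsum_sq] at h
  simp only [ofReal_weight_sq] at h
  refine le_trans (le_of_eq ?_) h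
  congr 1
  refine tsum_congr fun k => ?_
  rw [← mul_assoc, ← ENNReal.ofReal_mul (sobWeight_nonneg _ k), ← Real.rpow_add (by positivity)]
  rw [show -s / 2 + s / 2 = 0 by ring]
  simp

/-- Cauchy–Schwarz against `(1 + k²)^{-(s-r)/2}`, which is square summable because `s - r > 1/2`.
This is what makes multipliers of order `r` act by absolutely convergent series. -/
theorem MemSob.summable_weight {s r : ℝ} (hs : 1 / 2 < s - r) {u : S1 → ℝ} (hu : MemSob s u) :
    Summable fun k : ℤ => (1 + (k : ℝ) ^ 2) ^ (r / 2) * ‖coeff u k‖ := by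
  have h := ENNReal.tsum_mul_sq_le
    (fun k : ℤ => ENNReal.ofReal ((1 + (k : ℝ) ^ 2) ^ (-(s - r) / 2)))
    (fun k : ℤ => ENNReal.ofReal ((1 + (k : ℝ) ^ 2) ^ (s / 2)) * ‖coeff u k‖ₑ)
  rw [← sobE_eq_tsum_sq] at h
  simp only [ofReal_weight_sq] at h
  have h2 := ne_top_of_le_ne_top
    (ENNReal.mul_ne_top (embConst_ne_top hs) (memSob_iff.1 hu).2) h
  have h3 : ∑' k : ℤ, (ENNReal.ofReal ((1 + (k : ℝ) ^ 2) ^ (-(s - r) / 2))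
      * (ENNReal.ofReal ((1 + (k : ℝ) ^ 2) ^ (s / 2)) * ‖coeff u k‖ₑ)) ≠ ⊤ := by
    intro h3
    rw [h3] at h2
    simp at h2
  refine (ENNReal.summable_toReal h3).congr fun k => ?_
  simp only [ENNReal.toReal_mul, toReal_enorm, ENNReal.toReal_ofReal (sobWeight_nonneg _ k)]
  rw [← mul_assoc, ← Real.rpow_add (by positivity)]
  ring_nf

theorem MemSob.summable_norm {s : ℝ} (hs : 1 / 2 < s) {u : S1 → ℝ} (hu : MemSob s u) :
    Summable fun k => ‖coeff u k‖ := by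
  simpa using hu.summable_weight (r := 0) (by linarith)

/-- Only one factor needs an absolutely convergent Fourier series: it converges uniformly, so it can
be integrated termwise against the other. -/
theorem hasSum_coeff_mul {u v : S1 → ℝ} (hu : Continuous u) (hv : Continuous v)
    (h : Summable fun k => ‖coeff u k‖) (k : ℤ) :
    HasSum (fun l => coeff u l * coeff v (k - l)) (coeff (u * v) k) := by
  let V : C(S1, ℂ) := ⟨fun x => (v x : ℂ), by fun_prop⟩
  have h1 := ((hasSum_coeff_continuousMap hu h).mul_left (fourier (-k) * V)).mapL intCLM
  have e1 : intCLM (fourier (-k) * V * ⟨fun x => (u x : ℂ), by fun_prop⟩) = coeff (u * v) k := by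
    rw [intCLM_apply, coeff_eq]
    refine integral_congr_ae (Eventually.of_forall fun x => ?_)
    simp [V]
    ring
  rw [e1] at h1
  refine (congrArg (fun f => HasSum f _) (funext fun l => ?_)).mp h1
  rw [mul_smul_comm, map_smul, smul_eq_mul, intCLM_apply, coeff_eq v]
  congr 1
  refine integral_congr_ae (Eventually.of_forall fun x => ?_)
  simp only [ContinuousMap.mul_apply, V, ContinuousMap.coe_mk]
  rw [neg_sub, sub_eq_neg_add, fourier_add]
  ring

/-- The larger of `|l|` and `|k - l|` is at least `|k| / 2`. -/
theorem weight_le_add {s : ℝ} (hs : 0 ≤ s) (k l : ℤ) :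
    (1 + (k : ℝ) ^ 2) ^ (s / 2) ≤ 4 ^ (s / 2) * ((1 + (l : ℝ) ^ 2) ^ (s / 2)
      + (1 + ((k - l : ℤ) : ℝ) ^ 2) ^ (s / 2)) := by
  have h0 : 0 ≤ s / 2 := by linarith
  have hl : 0 ≤ (1 + (l : ℝ) ^ 2) ^ (s / 2) := by positivity
  have hm : 0 ≤ (1 + ((k - l : ℤ) : ℝ) ^ 2) ^ (s / 2) := by positivity
  have e : (k : ℝ) = l + (k - l : ℤ) := by push_cast; ring
  generalize ((k - l : ℤ) : ℝ) = m at *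
  rw [e]
  rcases le_total ((l : ℝ) ^ 2) (m ^ 2) with h | h
  · calc (1 + ((l : ℝ) + m) ^ 2) ^ (s / 2) ≤ (4 * (1 + m ^ 2)) ^ (s / 2) := by
          refine Real.rpow_le_rpow (by positivity) ?_ h0
          nlinarith [sq_nonneg ((l : ℝ) - m)]
      _ = 4 ^ (s / 2) * (1 + m ^ 2) ^ (s / 2) := Real.mul_rpow (by norm_num) (by positivity)
      _ ≤ _ := by gcongr; linarith
  · calc (1 + ((l : ℝ) + m) ^ 2) ^ (s / 2) ≤ (4 * (1 + (l : ℝ) ^ 2)) ^ (s / 2) := by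
          refine Real.rpow_le_rpow (by positivity) ?_ h0
          nlinarith [sq_nonneg ((l : ℝ) - m)]
      _ = 4 ^ (s / 2) * (1 + (l : ℝ) ^ 2) ^ (s / 2) := Real.mul_rpow (by norm_num) (by positivity)
      _ ≤ _ := by gcongr; linarith

theorem ENNReal.add_sq_le (x y : ℝ≥0∞) : (x + y) ^ 2 ≤ 2 * (x ^ 2 + y ^ 2) := by
  have := ENNReal.rpow_add_le_mul_rpow_add_rpow x y (p := 2) (by norm_num)
  norm_num at this
  exact this

/-- The constant in the product estimate for `H^s`. -/
noncomputable def mulConst (s : ℝ) : ℝ≥0∞ :=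
  ENNReal.ofReal (4 ^ (s / 2)) ^ 2 * (4 * embConst s)

theorem mulConst_ne_top {s : ℝ} (hs : 1 / 2 < s) : mulConst s ≠ ⊤ :=
  ENNReal.mul_ne_top (by finiteness) (ENNReal.mul_ne_top (by finiteness) (embConst_ne_top hs))

/-- The weight is shifted onto one factor or the other by `weight_le_add`; the weighted factor lies
in `ℓ²`, the free one in `ℓ¹`, and Young's inequality applies to both convolutions. -/
theorem sobE_mul_le {s : ℝ} (hs : 1 / 2 < s) {u v : S1 → ℝ} (hu : MemSob s u)
    (hv : Continuous v) : sobE s (u * v) ≤ mulConst s * (sobE s u * sobE s v) := by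
  set w : ℤ → ℝ≥0∞ := fun k => ENNReal.ofReal ((1 + (k : ℝ) ^ 2) ^ (s / 2)) with hw
  set C := ENNReal.ofReal (4 ^ (s / 2)) with hC
  have hw' : ∀ k l, w k ≤ C * (w l + w (k - l)) := by
    intro k l
    rw [hC, hw, ← ENNReal.ofReal_add (sobWeight_nonneg _ _) (sobWeight_nonneg _ _),
      ← ENNReal.ofReal_mul (by positivity)]
    exact ENNReal.ofReal_le_ofReal (weight_le_add (by linarith) k l)
  have h1 : ∀ k, (w k * ‖coeff (u * v) k‖ₑ) ^ 2 ≤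
      C ^ 2 * (2 * ((∑' l, (w l * ‖coeff u l‖ₑ) * ‖coeff v (k - l)‖ₑ) ^ 2
        + (∑' l, (w l * ‖coeff v l‖ₑ) * ‖coeff u (k - l)‖ₑ) ^ 2)) := by
    intro k
    have h2 : w k * ‖coeff (u * v) k‖ₑ ≤
        C * (∑' l, (w l * ‖coeff u l‖ₑ) * ‖coeff v (k - l)‖ₑ
          + ∑' l, (w l * ‖coeff v l‖ₑ) * ‖coeff u (k - l)‖ₑ) := by
      have h3 := (hasSum_coeff_mul hu.1 hv (hu.summable_norm hs) k).tsum_eq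
      have h4 : ∑' l, (w l * ‖coeff v l‖ₑ) * ‖coeff u (k - l)‖ₑ
          = ∑' l, (w (k - l) * ‖coeff v (k - l)‖ₑ) * ‖coeff u l‖ₑ := by
        rw [← (Equiv.subLeft k).tsum_eq]
        simp
      rw [h4, ← ENNReal.tsum_add, ← ENNReal.tsum_mul_left, ← h3]
      calc w k * ‖∑' l, coeff u l * coeff v (k - l)‖ₑ
          ≤ w k * ∑' l, ‖coeff u l * coeff v (k - l)‖ₑ := by
            gcongr
            exact enorm_tsum_le_tsum_enorm
        _ = ∑' l, w k * (‖coeff u l‖ₑ * ‖coeff v (k - l)‖ₑ) := by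
            rw [← ENNReal.tsum_mul_left]
            simp only [enorm_mul]
        _ ≤ _ := by
            refine ENNReal.tsum_le_tsum fun l => ?_
            calc w k * (‖coeff u l‖ₑ * ‖coeff v (k - l)‖ₑ)
                ≤ (C * (w l + w (k - l))) * (‖coeff u l‖ₑ * ‖coeff v (k - l)‖ₑ) := by
                  gcongr
                  exact hw' k l
              _ = _ := by ring
    refine (pow_le_pow_left' h2 2).trans ?_
    rw [mul_pow]
    gcongr
    exact ENNReal.add_sq_le _ _
  rw [sobE_eq_tsum_sq]
  refine (ENNReal.tsum_le_tsum h1).trans ?_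
  rw [ENNReal.tsum_mul_left, ENNReal.tsum_mul_left, ENNReal.tsum_add]
  calc _ ≤ C ^ 2 * (2 * (sobE s u * (∑' k, ‖coeff v k‖ₑ) ^ 2
          + sobE s v * (∑' k, ‖coeff u k‖ₑ) ^ 2)) := by
        rw [sobE_eq_tsum_sq s u, sobE_eq_tsum_sq s v]
        gcongr <;> exact ENNReal.tsum_convolution_sq_le _ _
    _ ≤ C ^ 2 * (2 * (sobE s u * (embConst s * sobE s v)
          + sobE s v * (embConst s * sobE s u))) := by
        gcongr <;> exact tsum_enorm_coeff_sq_le _ _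
    _ = _ := by rw [mulConst]; ring

theorem MemSob.mul {s : ℝ} (hs : 1 / 2 < s) {u v : S1 → ℝ} (hu : MemSob s u) (hv : MemSob s v) :
    MemSob s (u * v) :=
  memSob_iff.2 ⟨hu.1.mul hv.1, ne_top_of_le_ne_top (ENNReal.mul_ne_top (mulConst_ne_top hs)
    (ENNReal.mul_ne_top (memSob_iff.1 hu).2 (memSob_iff.1 hv).2)) (sobE_mul_le hs hu hv.1)⟩

theorem MemSob.add {s : ℝ} {u v : S1 → ℝ} (hu : MemSob s u) (hv : MemSob s v) :
    MemSob s (u + v) :=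
  (sobSubmodule s).add_mem hu hv

theorem MemSob.smul {s : ℝ} (c : ℝ) {u : S1 → ℝ} (hu : MemSob s u) : MemSob s (c • u) :=
  (sobSubmodule s).smul_mem c hu

/-! ### Classical derivatives and reciprocals of Sobolev functions. -/

/-- A function of class `H^s` with `s > 3/2` is continuously differentiable. -/
theorem MemSob.hasDx {s : ℝ} (hs : 3 / 2 < s) {u : S1 → ℝ} (hu : MemSob s u) :
    HasDx u (dx u) ∧ MemSob (s - 1) (dx u) := by
  have hsum := hu.summable_norm (by linarith)
  set d : ℤ → ℂ := fun k => 2 * Real.pi * Complex.I * k * coeff u k with hd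
  have hw : Summable fun k : ℤ => (1 + (k : ℝ) ^ 2) ^ (1 / 2 : ℝ) * ‖coeff u k‖ :=
    hu.summable_weight (by linarith)
  have hdn : ∀ k, ‖d k‖ ≤ 2 * Real.pi * ((1 + (k : ℝ) ^ 2) ^ (1 / 2 : ℝ) * ‖coeff u k‖) := by
    intro k
    have h1 : ‖d k‖ = 2 * Real.pi * (|(k : ℝ)| * ‖coeff u k‖) := by
      simp only [hd, norm_mul, Complex.norm_I, Complex.norm_real, Complex.norm_intCast,
        Real.norm_eq_abs, Complex.norm_ofNat, abs_of_pos Real.pi_pos]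
      ring
    rw [h1, ← Real.sqrt_eq_rpow]
    gcongr
    refine Real.abs_le_sqrt (by linarith)
  have hsum' : Summable fun k => ‖d k‖ :=
    Summable.of_nonneg_of_le (fun k => norm_nonneg _) hdn (hw.mul_left _)
  have h1 := hasDx_synth hsum hsum'
  rw [synth_coeff hu.1 hsum] at h1
  have h2 := h1.dx_eq
  rw [h2]
  exact ⟨h1, memSob_deriv h1 (continuous_synth hsum') hu⟩

theorem memSob_one_of_hasDx {u u' : S1 → ℝ} (h : HasDx u u') (hc : Continuous u') :
    MemSob 1 u :=
  memSob_of_hasDx h (by rw [sub_self]; exact memSob_zero hc)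

/-- Bootstrap with `(1/h)' = -h' (1/h)²`: the reciprocal is `C¹`, hence `H¹`, and each round gains
one derivative until `s` is reached. The products need `s - 1 > 1/2`. -/
theorem MemSob.inv {s : ℝ} (hs : 3 / 2 < s) {h : S1 → ℝ} (hh : MemSob s h)
    (h0 : ∀ x, h x ≠ 0) : MemSob s (fun x => (h x)⁻¹) := by
  obtain ⟨hd, hd'⟩ := hh.hasDx hs
  have hi := hd.inv h0
  have hc : Continuous fun x => -dx h x / h x ^ 2 :=
    hd'.1.neg.div (hh.1.pow 2) fun x => pow_ne_zero 2 (h0 x)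
  have key : ∀ n : ℕ, MemSob (min (1 + n) s) (fun x => (h x)⁻¹) := by
    intro n
    induction n with
    | zero => exact (memSob_one_of_hasDx hi hc).mono (by simp)
    | succ n ih =>
      refine memSob_of_hasDx hi ?_
      set t := min ((1 : ℝ) + n) (s - 1) with ht
      have ht' : 1 / 2 < t := lt_min (by linarith [n.cast_nonneg (α := ℝ)]) (by linarith)
      have e : min (1 + ((n + 1 : ℕ) : ℝ)) s - 1 ≤ t := by
        push_cast
        rw [← min_sub_sub_right, ht]
        exact min_le_min (by linarith) le_rfl
      refine MemSob.mono e ?_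
      have h1 : MemSob t (fun x => (h x)⁻¹) := ih.mono (min_le_min le_rfl (by linarith))
      have h2 : MemSob t (dx h) := hd'.mono (min_le_right _ _)
      have h3 := ((h2.mul ht' h1).mul ht' h1).smul (-1)
      refine (congrArg (MemSob t) ?_).mp h3
      ext x
      simp only [Pi.smul_apply, Pi.mul_apply, smul_eq_mul]
      field_simp
  obtain ⟨n, hn⟩ := exists_nat_ge s
  exact (key n).mono (le_min (by linarith) le_rfl)

/-! ### Change of variables, and composition in `L²` and `H²`. -/

theorem integral_comp_lift {E : Type*} [NormedAddCommGroup E] [NormedSpace ℝ E] [CompleteSpace E]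
    {φ : S1 → S1} {f f' : S1 → ℝ} (hφ : ∀ x : ℝ, φ x = ((x + f x : ℝ) : S1)) (hf : HasDx f f')
    (hf' : Continuous f') {G : S1 → E} (hG : Continuous G) :
    ∫ x, (1 + f' x) • G (φ x) ∂haar = ∫ x, G x ∂haar := by
  have h1 := intervalIntegral.integral_deriv_smul_comp (a := 0) (b := 1)
    (f := fun t : ℝ => t + f (t : S1)) (f' := fun t : ℝ => 1 + f' (t : S1))
    (g := fun t : ℝ => G (t : S1)) (fun x _ => (hasDerivAt_id x).add (hf x))
    (continuous_const.add (continuous_lift hf')).continuousOn (continuous_lift hG)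
  -- The lift carries `[0, 1]` to a period that starts at `f 0`, so the right-hand integral is
  -- unrolled from there.
  rw [integral_haar_eq 0, integral_haar_eq (0 + f ((0 : ℝ) : S1))]
  have e : ((1 : ℝ) : S1) = ((0 : ℝ) : S1) := by simp
  rw [e] at h1
  rw [show (0 : ℝ) + f ((0 : ℝ) : S1) + 1 = 1 + f ((0 : ℝ) : S1) by ring, ← h1, zero_add]
  refine intervalIntegral.integral_congr fun t _ => ?_
  simp [hφ]

/-- The map `ψ` of the circle has a lift `x ↦ x + g x` of class `C²` with positive derivative;
`g₁` and `g₂` are the derivatives of `g`. -/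
structure IsC2Lift (ψ : S1 → S1) (g g₁ g₂ : S1 → ℝ) : Prop where
  lift : ∀ x : ℝ, ψ x = ((x + g x : ℝ) : S1)
  hasDx : HasDx g g₁
  hasDx₁ : HasDx g₁ g₂
  continuous₂ : Continuous g₂
  pos : ∀ x, 0 < 1 + g₁ x

theorem continuous_of_eq_lift {φ : S1 → S1} {f : S1 → ℝ} (hf : Continuous f)
    (hφ : ∀ x : ℝ, φ x = ((x + f x : ℝ) : S1)) : Continuous φ := by
  refine continuous_of_lift ?_
  simp_rw [hφ]
  exact (AddCircle.continuous_mk' 1).comp (continuous_id.add (continuous_lift hf))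

theorem HasDx.comp_lift_smul {E : Type*} [NormedAddCommGroup E] [NormedSpace ℝ E] {ψ : S1 → S1}
    {g g₁ : S1 → ℝ} (hψ : ∀ x : ℝ, ψ x = ((x + g x : ℝ) : S1)) (hg : HasDx g g₁) {u u' : S1 → E}
    (hu : HasDx u u') : HasDx (u ∘ ψ) (fun x => (1 + g₁ x) • u' (ψ x)) := by
  intro x
  have h := HasDerivAt.scomp x (hu (x + g (x : S1))) ((hasDerivAt_id x).add (hg x))
  simpa [Function.comp_def, hψ] using h

theorem HasDx.comp_lift {ψ : S1 → S1} {g g₁ : S1 → ℝ} (hψ : ∀ x : ℝ, ψ x = ((x + g x : ℝ) : S1))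
    (hg : HasDx g g₁) {u u' : S1 → ℝ} (hu : HasDx u u') :
    HasDx (u ∘ ψ) ((u' ∘ ψ) * fun x => 1 + g₁ x) := by
  intro x
  exact (HasDx.comp_lift_smul hψ hg hu x).congr_deriv (mul_comm _ _)

theorem sobE_zero_mul_le {w h : S1 → ℝ} (hw : Continuous w) (hh : Continuous h) {C : ℝ}
    (hC : ∀ x, |h x| ≤ C) : sobE 0 (w * h) ≤ ENNReal.ofReal (C ^ 2) * sobE 0 w := by
  rw [sobE_zero (hw.mul hh), sobE_zero hw, ← ENNReal.ofReal_mul (by positivity)]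
  refine ENNReal.ofReal_le_ofReal ?_
  rw [← integral_const_mul]
  refine integral_mono (integrable_haar (by fun_prop)) (integrable_haar (by fun_prop)) fun x => ?_
  simp only [Pi.mul_apply]
  rw [mul_pow, mul_comm (C ^ 2)]
  have h1 := pow_le_pow_left₀ (abs_nonneg _) (hC x) 2
  rw [sq_abs] at h1
  exact mul_le_mul_of_nonneg_left h1 (sq_nonneg _)

theorem exists_abs_le {h : S1 → ℝ} (hh : Continuous h) : ∃ C, ∀ x, |h x| ≤ C := by
  obtain ⟨C, hC⟩ := isCompact_univ.exists_bound_of_continuousOn hh.continuousOn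
  exact ⟨C, fun x => hC x (mem_univ x)⟩

theorem exists_pos_le {h : S1 → ℝ} (hh : Continuous h) (h0 : ∀ x, 0 < h x) :
    ∃ c > 0, ∀ x, c ≤ h x := by
  obtain ⟨x, -, hx⟩ := isCompact_univ.exists_isMinOn univ_nonempty hh.continuousOn
  exact ⟨h x, h0 x, fun y => hx (mem_univ y)⟩

/-- The Jacobian `1 + g₁` has a positive minimum by compactness, and its inverse is the constant. -/
theorem sobE_zero_comp_le {ψ : S1 → S1} {g g₁ g₂ : S1 → ℝ} (hψ : IsC2Lift ψ g g₁ g₂) :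
    ∃ M : ℝ≥0∞, M ≠ ⊤ ∧ ∀ u : S1 → ℝ, Continuous u → sobE 0 (u ∘ ψ) ≤ M * sobE 0 u := by
  have hg₁ := hψ.hasDx₁.continuous
  have hc := continuous_of_eq_lift hψ.hasDx.continuous hψ.lift
  obtain ⟨c, hc0, hcle⟩ := exists_pos_le (continuous_const.add hg₁) hψ.pos
  refine ⟨ENNReal.ofReal c⁻¹, ENNReal.ofReal_ne_top, fun u hu => ?_⟩
  rw [sobE_zero (hu.comp hc), sobE_zero hu, ← ENNReal.ofReal_mul (by positivity)]
  refine ENNReal.ofReal_le_ofReal ?_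
  rw [← integral_comp_lift hψ.lift hψ.hasDx hg₁ (G := fun x => u x ^ 2) (hu.pow 2),
    ← integral_const_mul]
  have hcu := hu.comp hc
  refine integral_mono (integrable_haar (by fun_prop))
    (integrable_haar (continuous_const.mul ((continuous_const.add hg₁).smul (hcu.pow 2))))
    fun x => ?_
  simp only [Function.comp_apply, smul_eq_mul]
  rw [← mul_assoc]
  refine le_mul_of_one_le_left (sq_nonneg _) ?_
  rw [inv_mul_eq_div, one_le_div hc0]
  exact hcle x

theorem sobE_add_le {s : ℝ} {u v : S1 → ℝ} (hu : Continuous u) (hv : Continuous v) :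
    sobE s (u + v) ≤ 2 * (sobE s u + sobE s v) := by
  rw [sobE, sobE, sobE, ← ENNReal.tsum_add, ← ENNReal.tsum_mul_left]
  refine ENNReal.tsum_le_tsum fun k => ?_
  rw [coeff_add hu hv, ← mul_add, mul_left_comm]
  gcongr
  exact (pow_le_pow_left' (enorm_add_le _ _) 2).trans (ENNReal.add_sq_le _ _)

theorem sobE_two_le {v v₁ v₂ : S1 → ℝ} (h : HasDx v v₁) (h₁ : HasDx v₁ v₂) (hc : Continuous v₂) :
    sobE 2 v ≤ 2 * (sobE 0 v + sobE 0 v₂) := by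
  rw [sobE, sobE, sobE, ← ENNReal.tsum_add, ← ENNReal.tsum_mul_left]
  refine ENNReal.tsum_le_tsum fun k => ?_
  rw [← ofReal_sobTerm, ← ofReal_sobTerm, ← ofReal_sobTerm, ← ENNReal.ofReal_add (by positivity)
    (by positivity), show (2 : ℝ≥0∞) = ENNReal.ofReal 2 by simp, ← ENNReal.ofReal_mul (by norm_num)]
  refine ENNReal.ofReal_le_ofReal ?_
  rw [coeff_of_hasDx h₁ hc, coeff_of_hasDx h h₁.continuous]
  have hn : ‖2 * (Real.pi : ℂ) * Complex.I * k * (2 * Real.pi * Complex.I * k * coeff v k)‖ ^ 2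
      = (2 * Real.pi) ^ 4 * (k : ℝ) ^ 4 * ‖coeff v k‖ ^ 2 := by
    simp only [norm_mul, Complex.norm_I, Complex.norm_real, mul_pow, Complex.norm_intCast,
      sq_abs, Real.norm_eq_abs, Complex.norm_ofNat]
    ring
  rw [hn]
  simp only [Real.rpow_ofNat, Real.rpow_zero, one_mul]
  have hpi : (1 : ℝ) ≤ (2 * Real.pi) ^ 4 := one_le_pow₀ (by nlinarith [Real.pi_gt_three])
  have h4 : (k : ℝ) ^ 4 ≤ (2 * Real.pi) ^ 4 * (k : ℝ) ^ 4 :=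
    le_mul_of_one_le_left (by positivity) hpi
  rw [← one_add_mul, ← mul_assoc]
  gcongr
  nlinarith [sq_nonneg ((k : ℝ) ^ 2 - 1)]

/-- The second derivative of `b ∘ ψ` is `(b₂ ∘ ψ) (1 + g₁)² + (b₁ ∘ ψ) g₂`, so uniform bounds on
`g₁`, `g₂` and the `L²` estimate suffice. -/
theorem sobE_two_comp_le {ψ : S1 → S1} {g g₁ g₂ : S1 → ℝ} (hψ : IsC2Lift ψ g g₁ g₂) :
    ∃ M : ℝ≥0∞, M ≠ ⊤ ∧ ∀ b b₁ b₂ : S1 → ℝ, HasDx b b₁ → HasDx b₁ b₂ → Continuous b₂ →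
      sobE 2 (b ∘ ψ) ≤ M * sobE 2 b := by
  have hg₁ := hψ.hasDx₁.continuous
  have hg₂ := hψ.continuous₂
  have hc := continuous_of_eq_lift hψ.hasDx.continuous hψ.lift
  obtain ⟨M, hM, hM'⟩ := sobE_zero_comp_le hψ
  obtain ⟨C₁, hC₁⟩ := exists_abs_le ((continuous_const.add hg₁).mul (continuous_const.add hg₁) :
    Continuous ((fun x => 1 + g₁ x) * fun x => 1 + g₁ x))
  obtain ⟨C₂, hC₂⟩ := exists_abs_le hg₂
  set P := ENNReal.ofReal ((2 * Real.pi) ^ 2) with hP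
  refine ⟨2 * (M + 2 * (ENNReal.ofReal (C₁ ^ 2) * (M * (P * P))
    + ENNReal.ofReal (C₂ ^ 2) * (M * P))), ?_, fun b b₁ b₂ hb hb₁ hb₂ => ?_⟩
  · simp only [hP]
    finiteness
  have hv₁ := HasDx.comp_lift hψ.lift hψ.hasDx hb
  have hv₂ := (HasDx.comp_lift hψ.lift hψ.hasDx hb₁).mul ((HasDx.const 1).add hψ.hasDx₁)
  have hb₁c := hb₁.continuous
  have hbc := hb.continuous
  have c1 := hb₁c.comp hc
  have c2 := hb₂.comp hc
  have e : (b₂ ∘ ψ * fun x => 1 + g₁ x) * ((fun _ => 1) + g₁) + (b₁ ∘ ψ) * (0 + g₂)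
      = (b₂ ∘ ψ) * ((fun x => 1 + g₁ x) * fun x => 1 + g₁ x) + (b₁ ∘ ψ) * g₂ := by
    ext x
    simp
    ring
  rw [e] at hv₂
  have cp : Continuous ((fun x => 1 + g₁ x) * fun x => 1 + g₁ x) :=
    (continuous_const.add hg₁).mul (continuous_const.add hg₁)
  have h3 := sobE_two_le hv₁ hv₂ ((c2.mul cp).add (c1.mul hg₂))
  have d1 : sobE 0 b₁ ≤ P * sobE 2 b := by
    have := sobE_deriv_le (s := 1) hb hb₁c
    rw [sub_self] at this
    exact this.trans (by gcongr; exact sobE_mono (by norm_num) b)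
  have d2 : sobE 0 b₂ ≤ P * (P * sobE 2 b) := by
    have h5 := sobE_deriv_le (s := 1) hb₁ hb₂
    have h6 := sobE_deriv_le (s := 2) hb hb₁c
    rw [sub_self] at h5
    rw [show (2 : ℝ) - 1 = 1 by norm_num] at h6
    exact h5.trans (by gcongr)
  refine h3.trans ?_
  have h7 : sobE 0 (b ∘ ψ) ≤ M * sobE 2 b :=
    (hM' b hbc).trans (by gcongr; exact sobE_mono (by norm_num) b)
  have h8 := sobE_zero_mul_le c2 cp hC₁
  have h9 := sobE_zero_mul_le c1 hg₂ hC₂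
  calc _ ≤ 2 * (M * sobE 2 b + 2 * (ENNReal.ofReal (C₁ ^ 2) * (M * (P * (P * sobE 2 b)))
        + ENNReal.ofReal (C₂ ^ 2) * (M * (P * sobE 2 b)))) := by
        gcongr
        refine (sobE_add_le (c2.mul cp) (c1.mul hg₂)).trans ?_
        gcongr
        · exact h8.trans (by gcongr; exact (hM' _ hb₂).trans (by gcongr))
        · exact h9.trans (by gcongr; exact (hM' _ hb₁c).trans (by gcongr))
    _ = _ := by ring

/-! ### Interpolation between `L²` and `H²`, and composition in `H^s`. -/

/-- The square of the `K`-functional for the pair `(L², H²)`. -/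
noncomputable def kFun (t : ℝ) (u : S1 → ℝ) : ℝ≥0∞ :=
  ∑' k : ℤ, ENNReal.ofReal ((1 + (k : ℝ) ^ 2) ^ 2 / (t + (1 + (k : ℝ) ^ 2) ^ 2)) * ‖coeff u k‖ₑ ^ 2

/-- At each frequency, with `W = (1 + k²)²`, the factor `W / (t + W)` is the minimum of `|a|² + t⁻¹
W |b|²` subject to `a + b = 1`; the defect is the square `t⁻¹ (t a - W b)²`. -/
theorem kFun_add_le {t : ℝ} (ht : 0 < t) {x y : S1 → ℝ} (hx : Continuous x) (hy : Continuous y) :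
    kFun t (x + y) ≤ sobE 0 x + ENNReal.ofReal t⁻¹ * sobE 2 y := by
  rw [kFun, sobE, sobE, ← ENNReal.tsum_mul_left, ← ENNReal.tsum_add]
  refine ENNReal.tsum_le_tsum fun k => ?_
  rw [← ofReal_sobTerm, ← ofReal_sobTerm, ← ENNReal.ofReal_mul (by positivity),
    ← ENNReal.ofReal_add (by positivity) (by positivity), coeff_add hx hy, ← ofReal_norm,
    ← ENNReal.ofReal_pow (norm_nonneg _), ← ENNReal.ofReal_mul (by positivity)]
  refine ENNReal.ofReal_le_ofReal ?_
  simp only [Real.rpow_ofNat, Real.rpow_zero, one_mul]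
  have hW : 0 < (1 + (k : ℝ) ^ 2) ^ 2 := by positivity
  generalize (1 + (k : ℝ) ^ 2) ^ 2 = W at hW
  have h1 := norm_add_le (coeff x k) (coeff y k)
  have h0 := norm_nonneg (coeff x k + coeff y k)
  generalize ‖coeff x k + coeff y k‖ = z at *
  generalize ‖coeff x k‖ = a at *
  generalize ‖coeff y k‖ = b at *
  have h2 : z ^ 2 ≤ (a + b) ^ 2 := pow_le_pow_left₀ h0 h1 2
  rw [div_mul_eq_mul_div, div_le_iff₀ (by positivity)]
  have h3 : W * (a + b) ^ 2 ≤ (a ^ 2 + t⁻¹ * (W * b ^ 2)) * (t + W) := by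
    have : (a ^ 2 + t⁻¹ * (W * b ^ 2)) * (t + W) - W * (a + b) ^ 2 = t⁻¹ * (t * a - W * b) ^ 2 := by
      field_simp
      ring
    have : 0 ≤ t⁻¹ * (t * a - W * b) ^ 2 := by positivity
    linarith
  nlinarith

/-- The minimum is attained by the multipliers `W / (t + W)` for `a` and `t / (t + W)` for `b`. The
latter decays fast enough to make `b` of class `C²`, so the classical chain rule applies to `b ∘ ψ`.
-/
theorem exists_decomposition {t : ℝ} (ht : 0 < t) {u : S1 → ℝ} (hu : Continuous u)
    (hs : Summable fun k => ‖coeff u k‖) :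
    ∃ a b b₁ b₂ : S1 → ℝ, u = a + b ∧ Continuous a ∧ HasDx b b₁ ∧ HasDx b₁ b₂ ∧ Continuous b₂ ∧
      sobE 0 a + ENNReal.ofReal t⁻¹ * sobE 2 b = kFun t u := by
  set α : ℤ → ℝ := fun k => (1 + (k : ℝ) ^ 2) ^ 2 / (t + (1 + (k : ℝ) ^ 2) ^ 2) with hα
  set β : ℤ → ℝ := fun k => t / (t + (1 + (k : ℝ) ^ 2) ^ 2) with hβ
  have hαβ : ∀ k, α k + β k = 1 := fun k => by
    simp only [hα, hβ]
    field_simp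
    ring
  have hα0 : ∀ k, 0 ≤ α k := fun k => by positivity
  have hβ0 : ∀ k, 0 ≤ β k := fun k => by positivity
  have hαn : ∀ k, α (-k) = α k := fun k => by simp [hα]
  have hβn : ∀ k, β (-k) = β k := fun k => by simp [hβ]
  have hsa : Summable fun k => ‖(α k : ℂ) * coeff u k‖ := by
    refine Summable.of_nonneg_of_le (fun k => norm_nonneg _) (fun k => ?_) hs
    rw [norm_mul, Complex.norm_real, Real.norm_of_nonneg (hα0 k)]
    exact mul_le_of_le_one_left (norm_nonneg _) (by linarith [hαβ k, hβ0 k])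
  have hsb : Summable fun k => ‖(β k : ℂ) * coeff u k‖ := by
    refine Summable.of_nonneg_of_le (fun k => norm_nonneg _) (fun k => ?_) hs
    rw [norm_mul, Complex.norm_real, Real.norm_of_nonneg (hβ0 k)]
    exact mul_le_of_le_one_left (norm_nonneg _) (by linarith [hαβ k, hα0 k])
  have hkβ : ∀ k : ℤ, (k : ℝ) ^ 2 * β k ≤ t := by
    intro k
    simp only [hβ]
    rw [mul_div_assoc', div_le_iff₀ (by positivity)]
    nlinarith [sq_nonneg ((k : ℝ)), sq_nonneg ((k : ℝ) ^ 2)]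
  have hsb2 : Summable fun k : ℤ => ‖2 * (Real.pi : ℂ) * Complex.I * k *
      (2 * Real.pi * Complex.I * k * ((β k : ℂ) * coeff u k))‖ := by
    refine Summable.of_nonneg_of_le (fun k => norm_nonneg _) (fun k => ?_)
      (hs.mul_left ((2 * Real.pi) ^ 2 * t))
    have e : ‖2 * (Real.pi : ℂ) * Complex.I * k *
        (2 * Real.pi * Complex.I * k * ((β k : ℂ) * coeff u k))‖
        = (2 * Real.pi) ^ 2 * ((k : ℝ) ^ 2 * β k) * ‖coeff u k‖ := by
      simp only [norm_mul, Complex.norm_I, Complex.norm_real, Complex.norm_intCast,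
        Real.norm_eq_abs, Complex.norm_ofNat, abs_of_pos Real.pi_pos, abs_of_nonneg (hβ0 k)]
      rw [← sq_abs (k : ℝ)]
      ring
    rw [e]
    gcongr
    exact hkβ k
  have hsb1 : Summable fun k : ℤ => ‖2 * (Real.pi : ℂ) * Complex.I * k *
      ((β k : ℂ) * coeff u k)‖ := by
    refine Summable.of_nonneg_of_le (fun k => norm_nonneg _) (fun k => ?_) hsb2
    rw [norm_mul (2 * (Real.pi : ℂ) * Complex.I * k) (2 * Real.pi * Complex.I * k * _)]
    rcases eq_or_ne k 0 with rfl | hk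
    · simp
    refine le_mul_of_one_le_left (norm_nonneg _) ?_
    simp only [norm_mul, Complex.norm_I, Complex.norm_real, Complex.norm_intCast,
        Real.norm_eq_abs, Complex.norm_ofNat, abs_of_pos Real.pi_pos]
    have hk1 : (1 : ℝ) ≤ |(k : ℝ)| := by exact_mod_cast Int.one_le_abs hk
    nlinarith [Real.pi_gt_three]
  have hsya : ∀ k, ((α (-k) : ℝ) : ℂ) * coeff u (-k) = (starRingEnd ℂ) (α k * coeff u k) :=
    fun k => by rw [hαn, coeff_neg]; simp
  have hsyb : ∀ k, ((β (-k) : ℝ) : ℂ) * coeff u (-k) = (starRingEnd ℂ) (β k * coeff u k) :=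
    fun k => by rw [hβn, coeff_neg]; simp
  refine ⟨synth fun k => α k * coeff u k, synth fun k => β k * coeff u k, _, _, ?_,
    continuous_synth hsa, hasDx_synth hsb hsb1, hasDx_synth hsb1 hsb2, continuous_synth hsb2, ?_⟩
  · refine coeff_ext hu ((continuous_synth hsa).add (continuous_synth hsb)) fun k => ?_
    rw [coeff_add (continuous_synth hsa) (continuous_synth hsb), coeff_synth hsa hsya,
      coeff_synth hsb hsyb, ← add_mul, ← Complex.ofReal_add, hαβ]
    simp
  · rw [kFun, sobE, sobE, ← ENNReal.tsum_mul_left, ← ENNReal.tsum_add]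
    refine tsum_congr fun k => ?_
    rw [← ofReal_sobTerm, ← ofReal_sobTerm, ← ENNReal.ofReal_mul (by positivity),
      ← ENNReal.ofReal_add (by positivity) (by positivity), ← ofReal_norm,
      ← ENNReal.ofReal_pow (norm_nonneg _), ← ENNReal.ofReal_mul (by positivity),
      coeff_synth hsa hsya, coeff_synth hsb hsyb]
    congr 1
    simp only [Real.rpow_ofNat, Real.rpow_zero, one_mul, norm_mul, Complex.norm_real,
      Real.norm_eq_abs, mul_pow, sq_abs, hα, hβ]
    have hW : 0 < (1 + (k : ℝ) ^ 2) ^ 2 := by positivity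
    generalize (1 + (k : ℝ) ^ 2) ^ 2 = W at hW
    have hW' : t + W ≠ 0 := by positivity
    field_simp
    ring

/-- Composing the optimal decomposition of `u` gives an admissible one of `u ∘ ψ`, and each piece
obeys its endpoint bound. The constant does not depend on `t`. -/
theorem kFun_comp_le {ψ : S1 → S1} {g g₁ g₂ : S1 → ℝ} (hψ : IsC2Lift ψ g g₁ g₂) :
    ∃ M : ℝ≥0∞, M ≠ ⊤ ∧ ∀ u : S1 → ℝ, Continuous u → (Summable fun k => ‖coeff u k‖) →
      ∀ t > 0, kFun t (u ∘ ψ) ≤ M * kFun t u := by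
  obtain ⟨M₀, h₀, h₀'⟩ := sobE_zero_comp_le hψ
  obtain ⟨M₂, h₂, h₂'⟩ := sobE_two_comp_le hψ
  have hc := continuous_of_eq_lift hψ.hasDx.continuous hψ.lift
  refine ⟨M₀ + M₂, by finiteness, fun u hu hs t ht => ?_⟩
  obtain ⟨a, b, b₁, b₂, rfl, ha, hb, hb₁, hb₂, hk⟩ := exists_decomposition ht hu hs
  have e : (a + b) ∘ ψ = a ∘ ψ + b ∘ ψ := rfl
  rw [← hk, e]
  refine (kFun_add_le ht (ha.comp hc) (hb.continuous.comp hc)).trans ?_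
  calc _ ≤ M₀ * sobE 0 a + ENNReal.ofReal t⁻¹ * (M₂ * sobE 2 b) := by
        gcongr
        · exact h₀' a ha
        · exact h₂' b b₁ b₂ hb hb₁ hb₂
    _ ≤ (M₀ + M₂) * sobE 0 a + ENNReal.ofReal t⁻¹ * ((M₀ + M₂) * sobE 2 b) := by
        gcongr
        · exact le_self_add
        · exact le_add_self
    _ = _ := by ring

/-- For `0 < θ < 1` the integral of `t^{θ-1} W / (t + W)` over `t > 0` is a constant times `W^θ`;
here `θ = s / 2` and `W = (1 + k²)²`. -/
theorem sobE_eq_lintegral_kFun {s : ℝ} (hs : s ∈ Ioo (0 : ℝ) 2) : ∃ c : ℝ≥0∞, ∀ u : S1 → ℝ,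
    sobE s u = c * ∫⁻ t in Ioi (0 : ℝ), ENNReal.ofReal (t ^ (s / 2 - 1)) * kFun t u := by
  have hθ : s / 2 ∈ Ioo (0 : ℝ) 1 := ⟨by linarith [hs.1], by linarith [hs.2]⟩
  refine ⟨ENNReal.ofReal (∫ t in Ioi 0, Real.rpowIntegrand₀₁ (s / 2) t 1)⁻¹, fun u => ?_⟩
  have h1 : ∀ k : ℤ, ENNReal.ofReal ((1 + (k : ℝ) ^ 2) ^ s) =
      ENNReal.ofReal (∫ t in Ioi 0, Real.rpowIntegrand₀₁ (s / 2) t 1)⁻¹ *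
      ∫⁻ t in Ioi (0 : ℝ), ENNReal.ofReal (t ^ (s / 2 - 1)) *
        ENNReal.ofReal ((1 + (k : ℝ) ^ 2) ^ 2 / (t + (1 + (k : ℝ) ^ 2) ^ 2)) := by
    intro k
    have hW : 0 < (1 + (k : ℝ) ^ 2) ^ 2 := by positivity
    have e : (1 + (k : ℝ) ^ 2) ^ s = ((1 + (k : ℝ) ^ 2) ^ 2) ^ (s / 2) := by
      rw [← Real.rpow_natCast_mul (by positivity)]
      congr 1
      push_cast
      ring
    rw [e]
    generalize (1 + (k : ℝ) ^ 2) ^ 2 = W at hW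
    have hpos : ∀ t ∈ Ioi (0 : ℝ), ∀ x : ℝ, 0 ≤ x → 0 ≤ Real.rpowIntegrand₀₁ (s / 2) t x :=
      fun t ht x hx => Real.rpowIntegrand₀₁_nonneg hθ.1 (le_of_lt ht) hx
    rw [Real.rpow_eq_const_mul_integral hθ hW.le, ENNReal.ofReal_mul (inv_nonneg.2
      (setIntegral_nonneg measurableSet_Ioi fun t ht => hpos t ht 1 zero_le_one))]
    congr 1
    rw [ofReal_integral_eq_lintegral_ofReal
      (Real.integrableOn_rpowIntegrand₀₁_Ioi hθ hW.le)
      ((ae_restrict_mem measurableSet_Ioi).mono fun t ht => hpos t ht W hW.le)]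
    refine setLIntegral_congr_fun measurableSet_Ioi fun t ht => ?_
    have ht' : (0 : ℝ) < t := ht
    rw [← ENNReal.ofReal_mul (by positivity)]
    congr 1
    rw [Real.rpowIntegrand₀₁, Real.rpow_sub_one ht'.ne']
    field_simp
    ring
  have h2 : ∀ t, ENNReal.ofReal (t ^ (s / 2 - 1)) * kFun t u = ∑' k : ℤ,
      ENNReal.ofReal (t ^ (s / 2 - 1)) * ENNReal.ofReal ((1 + (k : ℝ) ^ 2) ^ 2 /
        (t + (1 + (k : ℝ) ^ 2) ^ 2)) * ‖coeff u k‖ₑ ^ 2 := by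
    intro t
    rw [kFun, ← ENNReal.tsum_mul_left]
    simp only [mul_assoc]
  simp_rw [h2]
  rw [lintegral_tsum (fun k => by fun_prop), sobE, ← ENNReal.tsum_mul_left]
  refine tsum_congr fun k => ?_
  rw [h1 k, lintegral_mul_const _ (by fun_prop), mul_assoc]

theorem MemSob.comp_of_lt_two {s : ℝ} (hs : 1 / 2 < s) (hs2 : s < 2) {ψ : S1 → S1}
    {g g₁ g₂ : S1 → ℝ} (hψ : IsC2Lift ψ g g₁ g₂) {u : S1 → ℝ} (hu : MemSob s u) :
    MemSob s (u ∘ ψ) := by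
  have hc := continuous_of_eq_lift hψ.hasDx.continuous hψ.lift
  obtain ⟨M, hM, hM'⟩ := kFun_comp_le hψ
  obtain ⟨c, hc'⟩ := sobE_eq_lintegral_kFun (s := s) ⟨by linarith, hs2⟩
  refine memSob_iff.2 ⟨hu.1.comp hc, ?_⟩
  refine ne_top_of_le_ne_top (ENNReal.mul_ne_top hM (memSob_iff.1 hu).2) ?_
  rw [hc', hc', mul_left_comm]
  gcongr
  rw [← lintegral_const_mul' _ _ hM]
  refine setLIntegral_mono' measurableSet_Ioi fun t ht => ?_
  rw [mul_left_comm]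
  gcongr
  exact hM' u hu.1 (hu.summable_norm hs) t ht

/-- Composition with a `C²` diffeomorphism of class `H^t` preserves `H^s` for `s ≤ t`. -/
theorem MemSob.comp {s t : ℝ} (hs : 1 / 2 < s) (hst : s ≤ t) {ψ : S1 → S1} {g g₁ g₂ : S1 → ℝ}
    (hψ : IsC2Lift ψ g g₁ g₂) (hg : MemSob t g) {u : S1 → ℝ} (hu : MemSob s u) :
    MemSob s (u ∘ ψ) := by
  obtain ⟨n, hn⟩ := exists_nat_ge s
  -- Interpolation covers every `s < 2`. For `s ≥ 2`, the formula `(u ∘ ψ)' = (u' ∘ ψ) (1 + g₁)`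
  -- reduces `s` to `s - 1 ≥ 1`, where `H^{s-1}` is still an algebra.
  have key : ∀ n : ℕ, ∀ s : ℝ, 1 / 2 < s → s ≤ t → s ≤ n + 3 / 2 → ∀ u : S1 → ℝ, MemSob s u →
      MemSob s (u ∘ ψ) := by
    intro n
    induction n with
    | zero =>
      intro s hs _ hs2 u hu
      exact hu.comp_of_lt_two hs (by norm_num at hs2; linarith) hψ
    | succ n ih =>
      intro s hs hst hn u hu
      rcases lt_or_ge s 2 with h | h
      · exact hu.comp_of_lt_two hs h hψ
      · obtain ⟨h1, h2⟩ := hu.hasDx (by linarith)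
        have h3 := ih (s - 1) (by linarith) (by linarith) (by push_cast at hn; linarith) _ h2
        refine memSob_of_hasDx (HasDx.comp_lift hψ.lift hψ.hasDx h1) (h3.mul (by linarith) ?_)
        exact (memSob_const (s - 1) 1).add
          (memSob_deriv hψ.hasDx hψ.hasDx₁.continuous (hg.mono hst))
  exact key n s hs hst (by linarith) u hu

/-! ### The action of `D^q` on Sobolev functions. -/

theorem IsSobLift.isC2Lift {q : ℝ} (hq : 5 / 2 < q) {φ : S1 ≃ₜ S1} {f : Sob q}
    (h : IsSobLift φ f) : IsC2Lift φ f (dx f) (dx (dx f)) := by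
  have h1 := MemSob.hasDx (by linarith) f.2
  have h2 := h1.2.hasDx (by linarith)
  exact ⟨h.1, h1.1, h2.1, h2.2.1, h.2⟩

namespace SobDiff

theorem memSob_R {q s : ℝ} (hq : 5 / 2 < q) (hs : 1 / 2 < s) (hsq : s ≤ q) (φ : SobDiff q)
    {u : S1 → ℝ} (hu : MemSob s u) : MemSob s (φ.R u) := by
  obtain ⟨f, hf⟩ := φ.mem
  exact MemSob.comp hs hsq (hf.isC2Lift hq) f.2 hu

theorem memSob_Rinv {q s : ℝ} (hq : 5 / 2 < q) (hs : 1 / 2 < s) (hsq : s ≤ q) (φ : SobDiff q)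
    {u : S1 → ℝ} (hu : MemSob s u) : MemSob s (φ.Rinv u) := by
  obtain ⟨f, hf⟩ := φ.mem_symm
  exact MemSob.comp hs hsq (hf.isC2Lift hq) f.2 hu

theorem R_Rinv {q : ℝ} (φ : SobDiff q) (u : S1 → ℝ) : φ.R (φ.Rinv u) = u := by
  ext x
  simp [R, Rinv]

theorem Rinv_R {q : ℝ} (φ : SobDiff q) (u : S1 → ℝ) : φ.Rinv (φ.R u) = u := by
  ext x
  simp [R, Rinv]

end SobDiff

/-! ### Inverse diffeomorphisms and the description of the lifts. -/

/-- The lift is strictly increasing, stays within bounded distance of the identity and commutes with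
the shift by `1`; so does its inverse, which therefore descends to the circle. -/
theorem exists_homeomorph_of_lift {f f' : S1 → ℝ} (hf : HasDx f f')
    (h0 : ∀ x, 0 < 1 + f' x) : ∃ (φ : S1 ≃ₜ S1) (g : S1 → ℝ),
      (∀ x : ℝ, φ x = ((x + f x : ℝ) : S1)) ∧ (∀ x : ℝ, φ.symm x = ((x + g x : ℝ) : S1)) ∧
      HasDx g fun y => (1 + f' (φ.symm y))⁻¹ - 1 := by
  have hfc := hf.continuous
  obtain ⟨C, hC⟩ := exists_abs_le hfc
  set Φ : ℝ → ℝ := fun x => x + f (x : S1) with hΦ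
  have hΦd : ∀ x : ℝ, HasDerivAt Φ (1 + f' (x : S1)) x := fun x => (hasDerivAt_id x).add (hf x)
  have hΦc : Continuous Φ := continuous_id.add (continuous_lift hfc)
  have hmono : StrictMono Φ := strictMono_of_deriv_pos fun x => by
    rw [(hΦd x).deriv]
    exact h0 x
  have hsurj : Function.Surjective Φ := by
    refine hΦc.surjective ?_ ?_
    · exact tendsto_atTop_add_right_of_le _ (-C) tendsto_id fun x => (abs_le.1 (hC x)).1
    · exact tendsto_atBot_add_right_of_ge _ C tendsto_id fun x => (abs_le.1 (hC x)).2
  let e := StrictMono.orderIsoOfSurjective Φ hmono hsurj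
  let Ψ : ℝ → ℝ := e.symm
  have hΨc : Continuous Ψ := e.symm.continuous
  have hΦΨ : ∀ y, Φ (Ψ y) = y := fun y => e.apply_symm_apply y
  have hΨΦ : ∀ y, Ψ (Φ y) = y := fun y => e.symm_apply_apply y
  have hΦ1 : ∀ x, Φ (x + 1) = Φ x + 1 := fun x => by
    have : ((x + 1 : ℝ) : S1) = (x : S1) := by simp
    simp only [hΦ, this]
    ring
  have hΨ1 : ∀ y, Ψ (y + 1) = Ψ y + 1 := fun y => by
    apply hmono.injective
    rw [hΦΨ, hΦ1, hΦΨ]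
  have hper : Function.Periodic (fun y => Ψ y - y) 1 := fun y => by
    simp only [hΨ1]
    ring
  let g : S1 → ℝ := hper.lift
  have hg : ∀ y : ℝ, g (y : S1) = Ψ y - y := fun y => rfl
  have hgc : Continuous g := continuous_of_lift (by
    simp_rw [hg]
    exact hΨc.sub continuous_id)
  have hf1 : ∀ x : ℝ, (x : S1) + ((f (x : S1) : ℝ) : S1) = ((Φ x : ℝ) : S1) := fun x => by
    simp [hΦ]
  have hg1 : ∀ x : ℝ, (x : S1) + ((g (x : S1) : ℝ) : S1) = ((Ψ x : ℝ) : S1) := fun x => by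
    rw [hg, ← AddCircle.coe_add]
    congr 1
    ring
  let φ : S1 ≃ₜ S1 :=
    { toFun := fun x => x + ((f x : ℝ) : S1)
      invFun := fun x => x + ((g x : ℝ) : S1)
      left_inv := fun x => by
        induction x using QuotientAddGroup.induction_on with
        | H x =>
          have := hf1 x
          simp only [this]
          rw [hg1, hΨΦ]
      right_inv := fun x => by
        induction x using QuotientAddGroup.induction_on with
        | H x =>
          have := hg1 x
          simp only [this]
          rw [hf1, hΦΨ]
      continuous_toFun := continuous_id.add ((AddCircle.continuous_mk' 1).comp hfc)
      continuous_invFun := continuous_id.add ((AddCircle.continuous_mk' 1).comp hgc) }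
  have hs : ∀ y : ℝ, φ.symm (y : S1) = ((Ψ y : ℝ) : S1) := hg1
  refine ⟨φ, g, fun x => hf1 x, fun y => ?_, fun y => ?_⟩
  · rw [hs, hg]
    congr 1
    ring
  · have h1 := HasDerivAt.of_local_left_inverse hΨc.continuousAt (hΦd (Ψ y)) (h0 _).ne'
      (Eventually.of_forall hΦΨ)
    simp only [hs]
    exact h1.sub (hasDerivAt_id y)

namespace SobDiff

/-- The Sobolev regularity of the inverse is automatic: its displacement satisfies `g' = 1 / (1 + f'
∘ φ⁻¹) - 1`, which allows a bootstrap. -/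
theorem mem_lifts_iff {q : ℝ} (hq : 5 / 2 < q) {f : Sob q} :
    f ∈ lifts q ↔ ∀ x, 0 < 1 + dx f x := by
  refine ⟨fun ⟨φ, h⟩ => h.2, fun h0 => ?_⟩
  obtain ⟨hf, hf'⟩ := MemSob.hasDx (by linarith) f.2
  obtain ⟨hf1, hf1'⟩ := hf'.hasDx (by linarith)
  obtain ⟨φ, g, hφ, hψ, hg⟩ := exists_homeomorph_of_lift hf h0
  have hg1 : HasDx (fun y => (1 + dx f (φ.symm y))⁻¹ - 1) _ :=
    (((HasDx.const (1 : ℝ)).add (HasDx.comp_lift hψ hg hf1)).inv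
      (fun y => (h0 (φ.symm y)).ne')).add (HasDx.const (-1 : ℝ))
  have hpos : ∀ y, 1 + ((1 + dx f (φ.symm y))⁻¹ - 1) = (1 + dx f (φ.symm y))⁻¹ := fun y => by ring
  have hlift : IsC2Lift φ.symm g _ _ := ⟨hψ, hg, hg1, by
    have hc1 := hf'.1
    have hc2 := hf1'.1
    have hc3 := φ.symm.continuous
    refine Continuous.add (Continuous.div ?_ ?_ ?_) continuous_const
    · exact (continuous_const.add ((hc2.comp hc3).mul
        (continuous_const.add hg1.continuous))).neg
    · exact (continuous_const.add (hc1.comp hc3)).pow 2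
    · exact fun x => pow_ne_zero 2 (h0 (φ.symm x)).ne', fun y => by
      rw [hpos]
      exact inv_pos.2 (h0 _)⟩
  -- The induction starts at `H²` because `g` is `C²`. Knowing `g` in a class allows composition
  -- with `φ⁻¹` up to that class, and the equation for `g'` then yields one more derivative, up to
  -- `q`.
  have key : ∀ n : ℕ, MemSob (min (2 + n) q) g := by
    intro n
    induction n with
    | zero =>
      refine MemSob.mono (min_le_left _ _) (memSob_of_hasDx hg ?_)
      simpa using (memSob_one_of_hasDx hg1 hlift.continuous₂).mono (by norm_num)
    | succ n ih =>
      refine memSob_of_hasDx hg ?_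
      set t := min ((2 : ℝ) + n) (q - 1) with ht
      have ht' : 3 / 2 < t := lt_min (by linarith [n.cast_nonneg (α := ℝ)]) (by linarith)
      have e : min (2 + ((n + 1 : ℕ) : ℝ)) q - 1 ≤ t := by
        push_cast
        rw [← min_sub_sub_right, ht]
        exact min_le_min (by linarith) le_rfl
      refine MemSob.mono e ?_
      have h1 : MemSob t (dx f ∘ φ.symm) :=
        MemSob.comp (by linarith) (min_le_min le_rfl (by linarith)) hlift ih
          (hf'.mono (min_le_right _ _))
      have h2 := (((memSob_const t 1).add h1).inv ht' fun y => (h0 (φ.symm y)).ne').add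
        (memSob_const t (-1))
      exact h2
  obtain ⟨n, hn⟩ := exists_nat_ge q
  have hgq : MemSob q g := (key n).mono (le_min (by linarith) le_rfl)
  refine ⟨⟨φ, ⟨f, hφ, h0⟩, ⟨⟨g, hgq⟩, hψ, fun x => ?_⟩⟩, hφ, h0⟩
  change 0 < 1 + dx g x
  rw [hg.dx_eq]
  exact hlift.pos x

theorem isSobLift_ofLift {q : ℝ} {f : Sob q} (hf : f ∈ lifts q) :
    IsSobLift (ofLift f).toHomeo f := by
  rw [ofLift, dif_pos hf]
  exact hf.choose_spec

end SobDiff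

/-! ### The spaces `H^s` as Banach spaces, their bounded operators, and openness of the lifts. -/

namespace Sob

/-- The element of `H^s` given by a function. -/
def mk {s : ℝ} (u : S1 → ℝ) (h : MemSob s u) : Sob s := ⟨u, h⟩

theorem coe_mk {s : ℝ} (u : S1 → ℝ) (h : MemSob s u) : (mk u h : S1 → ℝ) = u := rfl

theorem ext_coe {s : ℝ} {u v : Sob s} (h : (u : S1 → ℝ) = v) : u = v := Subtype.ext h

theorem norm_le_of_sobE_le {s t : ℝ} {u : Sob s} {v : Sob t} {C : ℝ≥0∞} (hC : C ≠ ⊤)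
    (h : sobE t v ≤ C * sobE s u) : ‖v‖ ≤ √C.toReal * ‖u‖ := by
  refine abs_le_of_sq_le_sq' ?_ (by positivity) |>.2
  rw [mul_pow, Real.sq_sqrt ENNReal.toReal_nonneg]
  rw [← Sob.ofReal_norm_sq, ← Sob.ofReal_norm_sq, ← ENNReal.ofReal_toReal hC,
    ← ENNReal.ofReal_mul ENNReal.toReal_nonneg] at h
  exact (ENNReal.ofReal_le_ofReal_iff (by positivity)).1 h

theorem sup_le {s : ℝ} (hs : 1 / 2 < s) (u : Sob s) (x : S1) :
    ‖(u x : ℂ)‖ ≤ √(embConst s).toReal * ‖u‖ := by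
  have hsum := MemSob.summable_norm hs u.2
  have h1 : ‖(u x : ℂ)‖ₑ ≤ ∑' k, ‖coeff u k‖ₑ := by
    rw [← (hasSum_coeff u.2.1 hsum x).tsum_eq]
    refine enorm_tsum_le_tsum_enorm.trans (ENNReal.tsum_le_tsum fun k => ?_)
    have hn : ‖(fourier k x : ℂ)‖ₑ = 1 := by
      rw [← ofReal_norm, show ‖(fourier k x : ℂ)‖ = 1 from Circle.norm_coe _]
      simp
    rw [enorm_mul, hn, mul_one]
  have h2 := (pow_le_pow_left' h1 2).trans (tsum_enorm_coeff_sq_le s u)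
  refine abs_le_of_sq_le_sq' ?_ (by positivity) |>.2
  rw [mul_pow, Real.sq_sqrt ENNReal.toReal_nonneg]
  rw [← Sob.ofReal_norm_sq, ← ENNReal.ofReal_toReal (embConst_ne_top hs), ← ofReal_norm,
    ← ENNReal.ofReal_pow (norm_nonneg _), ← ENNReal.ofReal_mul ENNReal.toReal_nonneg] at h2
  exact (ENNReal.ofReal_le_ofReal_iff (by positivity)).1 h2

/-- The embedding of `H^s` into the space of continuous functions. -/
noncomputable def toC {s : ℝ} (hs : 1 / 2 < s) : Sob s →L[ℝ] C(S1, ℂ) :=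
  LinearMap.mkContinuous
    { toFun := fun u => ⟨fun x => (u x : ℂ), by have := u.2.1; fun_prop⟩
      map_add' := fun u v => by
        ext x
        exact Complex.ofReal_add _ _
      map_smul' := fun c u => by
        ext x
        exact Complex.ofReal_mul _ _ } (√(embConst s).toReal)
    (fun u => (ContinuousMap.norm_le _ (by positivity)).2 fun x => sup_le hs u x)

theorem toC_apply {s : ℝ} (hs : 1 / 2 < s) (u : Sob s) (x : S1) : toC hs u x = (u x : ℂ) := rfl

/-- The derivative as a map from `H^q` to `H^t`, for `t ≤ q - 1`. -/
noncomputable def derivCLM {q t : ℝ} (hq : 3 / 2 < q) (ht : t ≤ q - 1) : Sob q →L[ℝ] Sob t :=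
  LinearMap.mkContinuous
    { toFun := fun u => ⟨dx u, (MemSob.hasDx hq u.2).2.mono ht⟩
      map_add' := fun u v => Subtype.ext
        ((MemSob.hasDx hq u.2).1.add (MemSob.hasDx hq v.2).1).dx_eq
      map_smul' := fun c u => Subtype.ext
        (HasDx.dx_eq fun x => ((MemSob.hasDx hq u.2).1 x).const_mul c) }
    (√(ENNReal.ofReal ((2 * Real.pi) ^ 2)).toReal)
    (fun u => norm_le_of_sobE_le ENNReal.ofReal_ne_top ((sobE_mono ht _).trans
      (sobE_deriv_le (MemSob.hasDx hq u.2).1 (MemSob.hasDx hq u.2).2.1)))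

/-- The multiplication of the algebra `H^s`. -/
noncomputable def mulCLM {s : ℝ} (hs : 1 / 2 < s) : Sob s →L[ℝ] Sob s →L[ℝ] Sob s :=
  LinearMap.mkContinuous₂
    (LinearMap.mk₂ ℝ (fun u v => ⟨(u : S1 → ℝ) * v, MemSob.mul hs u.2 v.2⟩)
      (fun _ _ _ => Subtype.ext (add_mul _ _ _)) (fun _ _ _ => Subtype.ext (smul_mul_assoc _ _ _))
      (fun _ _ _ => Subtype.ext (mul_add _ _ _)) (fun _ _ _ => Subtype.ext (mul_smul_comm _ _ _)))
    (√(mulConst s).toReal)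
    (fun u v => by
      rw [mul_assoc]
      refine abs_le_of_sq_le_sq' ?_ (by positivity) |>.2
      rw [mul_pow, Real.sq_sqrt ENNReal.toReal_nonneg, mul_pow]
      have h := sobE_mul_le hs u.2 v.2.1
      have h1 := Sob.ofReal_norm_sq (⟨(u : S1 → ℝ) * v, MemSob.mul hs u.2 v.2⟩ : Sob s)
      refine (ENNReal.ofReal_le_ofReal_iff (by positivity)).1 (h1.trans_le (h.trans ?_))
      rw [← Sob.ofReal_norm_sq, ← Sob.ofReal_norm_sq, ENNReal.ofReal_mul ENNReal.toReal_nonneg,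
        ENNReal.ofReal_toReal (mulConst_ne_top hs), ENNReal.ofReal_mul (by positivity)])

theorem isometry_toL2 {s : ℝ} : Isometry (toL2 (q := s)) :=
  AddMonoidHomClass.isometry_of_norm _ fun _ => rfl

/-- For `s > 1/2` undoing the weight turns an `ℓ²` sequence into a summable one, so conjugate
symmetry is the only constraint for it to come from a continuous real function. -/
theorem range_toL2 {s : ℝ} (hs : 1 / 2 < s) :
    range (toL2 (q := s)) = {a | ∀ k, a (-k) = (starRingEnd ℂ) (a k)} := by
  ext a
  refine ⟨?_, fun h => ?_⟩
  · rintro ⟨u, rfl⟩ k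
    change _ * coeff u (-k) = (starRingEnd ℂ) (_ * coeff u k)
    rw [coeff_neg]
    simp
  · set c : ℤ → ℂ := fun k => (((1 + (k : ℝ) ^ 2) ^ (-(s / 2)) : ℝ) : ℂ) * a k with hc
    have hwc : ∀ k : ℤ, (((1 + (k : ℝ) ^ 2) ^ (s / 2) : ℝ) : ℂ) * c k = a k := fun k => by
      rw [hc, ← mul_assoc, ← Complex.ofReal_mul, ← Real.rpow_add (by positivity), add_neg_cancel]
      simp
    have hsym : ∀ k, c (-k) = (starRingEnd ℂ) (c k) := fun k => by
      simp [hc, h k]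
    have ha : Summable fun k => ‖a k‖ ^ 2 := by
      have := (lp.memℓp a).summable (by norm_num)
      simpa using this
    have hsum : Summable fun k => ‖c k‖ := by
      have h1 := ENNReal.tsum_mul_sq_le
        (fun k : ℤ => ENNReal.ofReal ((1 + (k : ℝ) ^ 2) ^ (-s / 2))) (fun k : ℤ => ‖a k‖ₑ)
      simp only [ofReal_weight_sq] at h1
      have h2 : ∑' k, ‖a k‖ₑ ^ 2 ≠ ⊤ := by
        refine ne_of_eq_of_ne (tsum_congr fun k => ?_) ha.tsum_ofReal_ne_top
        rw [ENNReal.ofReal_pow (norm_nonneg _), ofReal_norm]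
      have h3 := ne_top_of_le_ne_top (ENNReal.mul_ne_top (embConst_ne_top hs) h2) h1
      have h4 : ∑' k : ℤ, ENNReal.ofReal ((1 + (k : ℝ) ^ 2) ^ (-s / 2)) * ‖a k‖ₑ ≠ ⊤ := by
        intro h4
        rw [h4] at h3
        simp at h3
      refine (ENNReal.summable_toReal h4).congr fun k => ?_
      simp only [ENNReal.toReal_mul, toReal_enorm, ENNReal.toReal_ofReal (sobWeight_nonneg _ k)]
      rw [hc, norm_mul, Complex.norm_real, Real.norm_of_nonneg (sobWeight_nonneg _ k), neg_div]
    have hmem : MemSob s (synth c) := by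
      refine ⟨continuous_synth hsum, ha.congr fun k => ?_⟩
      rw [coeff_synth hsum hsym, ← hwc, norm_mul, Complex.norm_real,
        Real.norm_of_nonneg (sobWeight_nonneg _ k), mul_pow, ← Real.rpow_mul_natCast (by positivity)]
      norm_num
    refine ⟨⟨synth c, hmem⟩, ?_⟩
    ext k
    change _ * coeff (synth c) k = a k
    rw [coeff_synth hsum hsym, hwc]

/-- Conjugate symmetry is a closed condition in `ℓ²`. Completeness is needed for the open mapping
theorem and for smoothness of operator inversion. -/
theorem completeSpace {s : ℝ} (hs : 1 / 2 < s) : CompleteSpace (Sob s) := by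
  rw [completeSpace_iff_isComplete_range isometry_toL2.isUniformInducing, range_toL2 hs]
  refine IsClosed.isComplete ?_
  simp only [ofPred_forall]
  refine isClosed_iInter fun k => ?_
  have hk : ∀ k : ℤ, Continuous fun a : lp (fun _ : ℤ => ℂ) 2 => a k := fun k =>
    (continuous_apply k).comp lp.uniformContinuous_coe.continuous
  exact isClosed_eq (hk _) (Complex.continuous_conj.comp (hk k))

end Sob

/-- Since `f ↦ f_x` is continuous into the uniform norm, a perturbation smaller than the minimum of
`1 + f_x` keeps it positive. -/
theorem SobDiff.isOpen_lifts {q : ℝ} (hq : 5 / 2 < q) : IsOpen (lifts q) := by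
  set D : Sob q →L[ℝ] C(S1, ℂ) := (Sob.toC (s := q - 1) (by linarith)).comp
    (Sob.derivCLM (by linarith) le_rfl) with hD
  have hDx : ∀ (f : Sob q) (x : S1), D f x = (dx f x : ℂ) := fun f x => rfl
  refine Metric.isOpen_iff.2 fun f hf => ?_
  rw [mem_lifts_iff hq] at hf
  obtain ⟨c, hc, hcle⟩ := exists_pos_le
    (continuous_const.add (MemSob.hasDx (by linarith) f.2).2.1) hf
  obtain ⟨ε, hε, h⟩ := Metric.continuous_iff.1 D.continuous f c hc
  refine ⟨ε, hε, fun f' hf' => (mem_lifts_iff hq).2 fun x => ?_⟩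
  have h1 := (ContinuousMap.dist_apply_le_dist x).trans_lt (h f' hf')
  rw [hDx, hDx, Complex.dist_eq, ← Complex.ofReal_sub, Complex.norm_real] at h1
  have h2 := (abs_lt.1 h1).1
  have h3 : c ≤ 1 + dx f x := hcle x
  linarith

/-! ### Fourier multipliers of order `r`. -/

section multiplier

variable {p : ℤ → ℂ} {r s : ℝ} {u : S1 → ℝ}

theorem summable_symbol_mul (hp : HasOrder p r) (hs : 1 / 2 < s - r) (hu : MemSob s u) :
    Summable fun k => ‖p k * coeff u k‖ := by
  obtain ⟨C, hC, hpC⟩ := hp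
  refine Summable.of_nonneg_of_le (fun k => norm_nonneg _) (fun k => ?_)
    ((hu.summable_weight hs).mul_left C)
  rw [norm_mul, ← mul_assoc]
  gcongr
  exact hpC k

theorem continuous_op (hp : HasOrder p r) (hs : 1 / 2 < s - r) (hu : MemSob s u) :
    Continuous (op p u) :=
  continuous_synth (summable_symbol_mul hp hs hu)

theorem coeff_op (hp : HasOrder p r) (hreal : ∀ k : ℤ, p (-k) = (starRingEnd ℂ) (p k))
    (hs : 1 / 2 < s - r) (hu : MemSob s u) (k : ℤ) : coeff (op p u) k = p k * coeff u k :=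
  coeff_synth (summable_symbol_mul hp hs hu) (fun k => by rw [hreal, coeff_neg, map_mul]) k

theorem memSob_op (hp : HasOrder p r) (hreal : ∀ k : ℤ, p (-k) = (starRingEnd ℂ) (p k))
    (hs : 1 / 2 < s - r) (hu : MemSob s u) : MemSob (s - r) (op p u) := by
  refine ⟨continuous_op hp hs hu, ?_⟩
  simp_rw [coeff_op hp hreal hs hu]
  obtain ⟨C, hC, hpC⟩ := hp
  refine Summable.of_nonneg_of_le (fun k => by positivity) (fun k => ?_) (hu.2.mul_left (C ^ 2))
  have hw : (1 + (k : ℝ) ^ 2) ^ s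
      = (1 + (k : ℝ) ^ 2) ^ (s - r) * ((1 + (k : ℝ) ^ 2) ^ (r / 2)) ^ 2 := by
    rw [← Real.rpow_mul_natCast (by positivity), ← Real.rpow_add (by positivity)]
    congr 1
    push_cast
    ring
  calc (1 + (k : ℝ) ^ 2) ^ (s - r) * ‖p k * coeff u k‖ ^ 2
      ≤ (1 + (k : ℝ) ^ 2) ^ (s - r) * ((C * (1 + (k : ℝ) ^ 2) ^ (r / 2)) * ‖coeff u k‖) ^ 2 := by
        rw [norm_mul]
        gcongr
        exact hpC k
    _ = _ := by rw [hw]; ring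

theorem op_dx (hp : HasOrder p r) (hreal : ∀ k : ℤ, p (-k) = (starRingEnd ℂ) (p k))
    (hr : 0 ≤ r) (hs : 3 / 2 < s - r) (hu : MemSob s u) : op p (dx u) = dx (op p u) := by
  obtain ⟨h1, h2⟩ := hu.hasDx (by linarith)
  have h3 := memSob_op hp hreal (by linarith) hu
  obtain ⟨h4, h5⟩ := h3.hasDx hs
  refine coeff_ext (continuous_op hp (by linarith) h2) h5.1 fun k => ?_
  rw [coeff_op hp hreal (by linarith) h2, coeff_of_hasDx h1 h2.1, coeff_of_hasDx h4 h5.1,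
    coeff_op hp hreal (by linarith) hu]
  ring

end multiplier

/-! ### The derivative of `φ ↦ A_φ`. -/

/-- Substituting `y = φ(x)` removes `φ⁻¹` from the integrand, leaving an explicit dependence on the
lift of `φ`. -/
theorem coeff_comp_symm {φ : S1 ≃ₜ S1} {f f' : S1 → ℝ}
    (hφ : ∀ x : ℝ, φ x = ((x + f x : ℝ) : S1)) (hf : HasDx f f') (hf' : Continuous f')
    {w : S1 → ℝ} (hw : Continuous w) (k : ℤ) :
    coeff (w ∘ φ.symm) k = ∫ x, (w x : ℂ) * fourier (-k) (φ x) * ((1 + f' x : ℝ) : ℂ) ∂haar := by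
  have h := integral_comp_lift hφ hf hf' (G := fun y => fourier (-k) y * ((w (φ.symm y) : ℝ) : ℂ))
    (by have := hw.comp φ.symm.continuous; simp only [Function.comp_def] at this; fun_prop)
  rw [coeff_eq]
  refine h.symm.trans (integral_congr_ae (Eventually.of_forall fun x => ?_))
  simp only [Homeomorph.symm_apply_apply, Complex.real_smul]
  ring

/-- Integration by parts: adding `U'(φ) e_{-k}(φ) v φ_x` to the integrand gives the total derivative
of `U(φ) e_{-k}(φ) v`. The left side is the part of the `t`-derivative of a coefficient that comes
from moving `φ`. -/
theorem integral_transport {φ : S1 ≃ₜ S1} {f f' : S1 → ℝ}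
    (hφ : ∀ x : ℝ, φ x = ((x + f x : ℝ) : S1)) (hf : HasDx f f') (hf' : Continuous f')
    {v v' : S1 → ℝ} (hv : HasDx v v') (hv' : Continuous v') {U U' : S1 → ℝ} (hU : HasDx U U')
    (hU' : Continuous U') (k : ℤ) :
    ∫ x, ((U (φ x) : ℂ) * fourier (-k) (φ x) * (-(2 * Real.pi * Complex.I * k) * (v x : ℂ))
        * ((1 + f' x : ℝ) : ℂ) + (U (φ x) : ℂ) * fourier (-k) (φ x) * (v' x : ℂ)) ∂haar
      = -coeff ((v ∘ φ.symm) * U') k := by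
  have hφc := φ.continuous
  have hvc := hv.continuous
  have hUc := hU.continuous
  have h1 := (HasDx.comp_lift_smul hφ hf (HasDx.mul hU.ofReal (hasDx_fourier (-k)))).mul hv.ofReal
  have h2 := integral_eq_zero_of_hasDx h1 (by
    simp only [Function.comp_def, Complex.real_smul, Pi.mul_apply, Pi.add_apply]
    refine Continuous.add (Continuous.mul ?_ ?_) (Continuous.mul ?_ ?_) <;> fun_prop)
  have e : (v ∘ φ.symm) * U' = (v * (U' ∘ φ)) ∘ φ.symm := by
    ext x
    simp
  rw [e, coeff_comp_symm hφ hf hf' (hvc.mul (hU'.comp hφc)), eq_neg_iff_add_eq_zero, ← h2,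
    ← integral_add (integrable_haar (by fun_prop)) (integrable_haar (by
      simp only [Pi.mul_apply, Function.comp_apply]; fun_prop))]
  refine integral_congr_ae (Eventually.of_forall fun x => ?_)
  simp only [Function.comp_def, Complex.real_smul, Pi.mul_apply, Pi.add_apply]
  push_cast
  ring

/-- The product rule in the Banach algebra `C(S1, ℂ)`, where `exp (t • a)` is a differentiable
curve; no differentiation under the integral sign is needed. -/
theorem hasDerivAt_intCLM_exp {w : ℝ → C(S1, ℂ)} {w' : C(S1, ℂ)} (hw : HasDerivAt w w' 0)
    (E a ρ ρ' : C(S1, ℂ)) :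
    HasDerivAt (fun t : ℝ => intCLM (w t * (E * NormedSpace.exp (t • a)) * (ρ + t • ρ')))
      (intCLM (w' * E * ρ) + intCLM (w 0 * E * a * ρ + w 0 * E * ρ')) 0 := by
  have h1 : HasDerivAt (fun t : ℝ => NormedSpace.exp (t • a)) (a * NormedSpace.exp ((0 : ℝ) • a)) 0 :=
    hasDerivAt_exp_smul_const' a (0 : ℝ)
  have h2 : HasDerivAt (fun t : ℝ => ρ + t • ρ') ρ' 0 := by
    simpa using ((hasDerivAt_id (0 : ℝ)).smul_const ρ').const_add ρ
  have h3 := (hw.mul (h1.const_mul E)).mul h2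
  have h4 := (intCLM.restrictScalars ℝ).hasFDerivAt.comp_hasDerivAt (0 : ℝ) h3
  refine h4.congr_deriv ?_
  rw [← map_add]
  change intCLM _ = intCLM _
  congr 1
  have ha : (0 : ℝ) • a = 0 := zero_smul ℝ a
  have hρ : (0 : ℝ) • ρ' = 0 := zero_smul ℝ ρ'
  simp only [ha, hρ, NormedSpace.exp_zero, Pi.mul_apply]
  ring

theorem exp_smul_apply (a : C(S1, ℂ)) (t : ℝ) (x : S1) :
    NormedSpace.exp (t • a) x = Complex.exp (t * a x) := by
  have h := NormedSpace.map_exp (ContinuousMap.evalAlgHom ℂ ℂ x) (continuous_eval_const x) (t • a)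
  rw [← Complex.exp_eq_exp_ℂ] at h
  exact h

namespace SobDiff

/-- A lift determines its diffeomorphism, so the choice made in `ofLift` is immaterial. -/
theorem ofLift_eq {q : ℝ} {φ : SobDiff q} {f : Sob q} (h : IsSobLift φ.toHomeo f) :
    ofLift f = φ := by
  have h1 := isSobLift_ofLift (f := f) ⟨φ, h⟩
  have h2 : (ofLift f).toHomeo = φ.toHomeo := by
    ext x
    induction x using QuotientAddGroup.induction_on with
    | H x => exact (h1.1 x).trans (h.1 x).symm
  cases hφ : ofLift f
  cases φ
  simp only [hφ] at h2
  subst h2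
  rfl

end SobDiff

open SobDiff

theorem SobDiff.ofLift_add_smul_apply {q : ℝ} {f v : Sob q} {t : ℝ} (hf : f ∈ lifts q)
    (hft : f + t • v ∈ lifts q) (x : S1) :
    (ofLift (f + t • v)).toHomeo x = (ofLift f).toHomeo x + ((t * v x : ℝ) : S1) := by
  induction x using QuotientAddGroup.induction_on with
  | H x =>
    have h1 := (isSobLift_ofLift hft).1 x
    have h2 := (isSobLift_ofLift hf).1 x
    refine h1.trans ?_
    rw [show (ofLift f).toHomeo (x : S1) = _ from h2, ← AddCircle.coe_add, add_assoc]
    rfl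

/-- Along `f + t v` the character `e_{-k}(φ_t)` is `e_{-k}(φ)` times `exp (t a)`, and the Jacobian
is affine in `t`. -/
theorem coeff_comp_ofLift_symm {q : ℝ} (hq : 5 / 2 < q) {f v : Sob q} (hf : f ∈ lifts q) (k : ℤ)
    {E a ρ ρ' : C(S1, ℂ)} (hE : ∀ x, E x = fourier (-k) ((ofLift f).toHomeo x))
    (ha : ∀ x, a x = -(2 * Real.pi * Complex.I * k) * (v x : ℂ))
    (hρ : ∀ x, ρ x = ((1 + dx f x : ℝ) : ℂ)) (hρ' : ∀ x, ρ' x = (dx v x : ℂ))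
    {t : ℝ} (hft : f + t • v ∈ lifts q) {w : S1 → ℝ} (hw : Continuous w) {W : C(S1, ℂ)}
    (hW : ∀ x, W x = (w x : ℂ)) :
    coeff ((ofLift (f + t • v)).Rinv w) k
      = intCLM (W * (E * NormedSpace.exp (t • a)) * (ρ + t • ρ')) := by
  have hL := isSobLift_ofLift hft
  have hd := MemSob.hasDx (s := q) (by linarith) (f + t • v).2
  rw [Rinv, coeff_comp_symm hL.1 hd.1 hd.2.1 hw, intCLM_apply]
  refine integral_congr_ae (Eventually.of_forall fun x => ?_)
  have h1 : dx (f + t • v : Sob q) x = dx f x + t * dx v x := by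
    have h2 := (Sob.derivCLM (q := q) (t := q - 1) (by linarith) le_rfl).map_add f (t • v)
    rw [map_smul] at h2
    exact congrArg (fun u : Sob (q - 1) => u x) h2
  have h3 : (fourier (-k) ((t * v x : ℝ) : S1) : ℂ) = Complex.exp (t * a x) := by
    rw [fourier_coe_apply, ha]
    congr 1
    push_cast
    ring
  have h4 : ∀ y z : S1, (fourier (-k) (y + z) : ℂ) = fourier (-k) y * fourier (-k) z := fun y z => by
    simp [fourier_apply, AddCircle.toCircle_add]
  simp only [ContinuousMap.mul_apply, ContinuousMap.add_apply, ContinuousMap.smul_apply]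
  rw [ofLift_add_smul_apply hf hft, h4, h3, h1, exp_smul_apply, hW, hE, hρ, hρ', Complex.real_smul]
  push_cast
  ring

/-- The derivative of `φ ↦ A_φ v` in the direction `v` is `-R_φ [A, u] u_x` with `u = v ∘ φ⁻¹`. -/
theorem Rinv_fderiv_conj_apply {r q : ℝ} (hr : 1 ≤ r) (hq : 3 / 2 + r < q) {p : ℤ → ℂ}
    (hp : HasOrder p r) (hreal : ∀ k : ℤ, p (-k) = (starRingEnd ℂ) (p k))
    {Aφ : SobDiff q → (Sob q →L[ℝ] Sob (q - r))}
    (hAφ : ∀ (φ : SobDiff q) (v : Sob q), (Aφ φ v : S1 → ℝ) = φ.R (op p (φ.Rinv v)))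
    (hsmooth : SobDiff.Smooth Aφ) {f : Sob q} (hf : f ∈ lifts q) (v : Sob q) :
    (ofLift f).Rinv (fderiv ℝ (fun f => Aφ (ofLift f)) f v v)
      = -opCommutator p ((ofLift f).Rinv v) (dx ((ofLift f).Rinv v)) := by
  have hq' : 5 / 2 < q := by linarith
  have hs : 1 / 2 < q - r := by linarith
  set φ := ofLift f with hφ
  have hL : IsSobLift φ.toHomeo f := isSobLift_ofLift hf
  set u : S1 → ℝ := φ.Rinv v with hu
  have huq : MemSob q u := memSob_Rinv hq' (by linarith) le_rfl φ v.2
  obtain ⟨hux, hux'⟩ := huq.hasDx (by linarith)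
  have hAu := memSob_op hp hreal hs huq
  obtain ⟨hAux, hAux'⟩ := hAu.hasDx (by linarith)
  have huux : MemSob (q - 1) (u * dx u) := (huq.mono (by linarith)).mul (by linarith) hux'
  obtain ⟨hvx, hvx'⟩ := MemSob.hasDx (s := q) (by linarith) v.2
  obtain ⟨hfx, hfx'⟩ := MemSob.hasDx (s := q) (by linarith) f.2
  set B : Sob q → (Sob q →L[ℝ] Sob (q - r)) := fun f => Aφ (ofLift f) with hB
  have hnhds : lifts q ∈ 𝓝 f := (isOpen_lifts hq').mem_nhds hf
  have hBd : HasFDerivAt B (fderiv ℝ B f) f :=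
    ((hsmooth.contDiffAt hnhds).differentiableAt (by simp)).hasFDerivAt
  set W := fderiv ℝ B f v v with hW
  have hcurve : HasDerivAt (fun t : ℝ => f + t • v) v 0 := by
    simpa using ((hasDerivAt_id (0 : ℝ)).smul_const v).const_add f
  have hf0 : f + (0 : ℝ) • v = f := by simp
  have hBd0 : HasFDerivAt B (fderiv ℝ B f) (f + (0 : ℝ) • v) := by rw [hf0]; exact hBd
  have hBc : HasDerivAt (fun t : ℝ => B (f + t • v)) (fderiv ℝ B f v) 0 :=
    HasFDerivAt.comp_hasDerivAt (l := B) (l' := fderiv ℝ B f) (0 : ℝ) hBd0 hcurve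
  have hwc : HasDerivAt (fun t : ℝ => Sob.toC hs (B (f + t • v) v)) (Sob.toC hs W) 0 :=
    ((Sob.toC hs).comp (ContinuousLinearMap.apply ℝ (Sob (q - r)) v)).hasFDerivAt.comp_hasDerivAt
      (0 : ℝ) hBc
  have hev : ∀ᶠ t in 𝓝 (0 : ℝ), f + t • v ∈ lifts q :=
    hcurve.continuousAt.eventually_mem (by rw [hf0]; exact hnhds)
  have hφc := φ.toHomeo.continuous
  have hvc := v.2.1
  -- This is the derivative at `t = 0` of the identity that the `k`-th coefficient of `R_{φ_t⁻¹}
  -- A_{φ_t} v` is `p k` times that of `R_{φ_t⁻¹} v`.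
  have key : ∀ k, coeff (φ.Rinv W) k + -coeff (u * dx (op p u)) k
      = p k * -coeff (u * dx u) k := by
    intro k
    let E : C(S1, ℂ) := ⟨fun x => fourier (-k) (φ.toHomeo x), by fun_prop⟩
    let a : C(S1, ℂ) := ⟨fun x => -(2 * Real.pi * Complex.I * k) * (v x : ℂ), by fun_prop⟩
    let ρ : C(S1, ℂ) := ⟨fun x => ((1 + dx f x : ℝ) : ℂ), by have := hfx'.1; fun_prop⟩
    let ρ' : C(S1, ℂ) := ⟨fun x => (dx v x : ℂ), by have := hvx'.1; fun_prop⟩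
    let V : C(S1, ℂ) := Sob.toC (s := q) (by linarith) v
    have hcoef : ∀ {t : ℝ}, f + t • v ∈ lifts q → ∀ {w : S1 → ℝ}, Continuous w →
        ∀ {W : C(S1, ℂ)}, (∀ x, W x = (w x : ℂ)) → coeff ((ofLift (f + t • v)).Rinv w) k
        = intCLM (W * (E * NormedSpace.exp (t • a)) * (ρ + t • ρ')) := fun hft _ hw _ hW =>
      coeff_comp_ofLift_symm hq' hf k (fun _ => rfl) (fun _ => rfl) (fun _ => rfl)
        (fun _ => rfl) hft hw hW
    have h1 := hasDerivAt_intCLM_exp hwc E a ρ ρ'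
    have h2 := (hasDerivAt_intCLM_exp (hasDerivAt_const (0 : ℝ) V) E a ρ ρ').const_mul (p k)
    have h3 : (fun t : ℝ => intCLM (Sob.toC hs (B (f + t • v) v) * (E * NormedSpace.exp (t • a))
        * (ρ + t • ρ'))) =ᶠ[𝓝 0]
        fun t => p k * intCLM (V * (E * NormedSpace.exp (t • a)) * (ρ + t • ρ')) := by
      filter_upwards [hev] with t ht
      rw [← hcoef ht (B (f + t • v) v).2.1 (fun x => Sob.toC_apply hs _ x),
        ← hcoef ht v.2.1 (fun x => rfl), hB, hAφ, Rinv_R]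
      exact coeff_op hp hreal hs (memSob_Rinv hq' (by linarith) le_rfl _ v.2) k
    -- Both sides of the identity have been differentiated; uniqueness of the derivative equates the
    -- results.
    have h4 := (h1.congr_of_eventuallyEq h3.symm).unique h2
    have h5 : intCLM (Sob.toC hs W * E * ρ) = coeff (φ.Rinv W) k := by
      rw [Rinv, coeff_comp_symm hL.1 hfx hfx'.1 W.2.1]
      rfl
    have h6 : ∀ {U U' : S1 → ℝ}, HasDx U U' → Continuous U' → ∀ {w : C(S1, ℂ)},
        (∀ x, w x = (U (φ.toHomeo x) : ℂ)) →
        intCLM (w * E * a * ρ + w * E * ρ') = -coeff (u * U') k := by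
      intro U U' hU hU' w hw
      rw [hu, Rinv, ← integral_transport hL.1 hfx hfx'.1 hvx hvx'.1 hU hU' k, intCLM_apply]
      refine integral_congr_ae (Eventually.of_forall fun x => ?_)
      simp only [ContinuousMap.add_apply, ContinuousMap.mul_apply, hw]
      rfl
    rw [h5, hf0, h6 hAux hAux'.1 (fun x => ?_), h6 hux hux'.1 (fun x => ?_)] at h4
    · simpa using h4
    · change ((v x : ℝ) : ℂ) = _
      simp [hu, Rinv]
    · rw [Sob.toC_apply, hB, hAφ]
      rfl
  -- Since `A` commutes with the derivative, `[A,u] u_x = A(u u_x) - u (Au)_x`, the combination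
  -- produced by `key`.
  have hcom : -opCommutator p u (dx u) = u * dx (op p u) + (-1 : ℝ) • op p (u * dx u) := by
    rw [opCommutator, op_dx hp hreal (by linarith) (by linarith) huq]
    ext x
    simp
    ring
  have hc1 := huq.1.mul hAux'.1
  have hc2 := continuous_op hp (by linarith) huux
  rw [hcom]
  refine coeff_ext (W.2.1.comp φ.toHomeo.symm.continuous) (hc1.add (hc2.const_smul _)) fun k => ?_
  rw [coeff_add hc1 (hc2.const_smul _), coeff_smul, coeff_op hp hreal (by linarith) huux]
  push_cast
  linear_combination key k

/-! ### Invertibility of multiplication by `1 + f_x` and of `A_φ`. -/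

/-- Multiplication by `1 + f_x` as an operator on `H^s`. -/
noncomputable def mulOneAddDeriv {q s : ℝ} (hq : 3 / 2 < q) (hsq : s ≤ q - 1) (hs : 1 / 2 < s)
    (f : Sob q) : Sob s →L[ℝ] Sob s :=
  Sob.mulCLM hs (Sob.mk (fun _ => 1) (memSob_const s 1) + Sob.derivCLM hq hsq f)

theorem isInvertible_mulOneAddDeriv {q s : ℝ} (hq : 5 / 2 < q) (hsq : s ≤ q - 1) (hs : 1 / 2 < s)
    {f : Sob q} (hf : f ∈ lifts q) : (mulOneAddDeriv (by linarith) hsq hs f).IsInvertible := by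
  have h0 := (mem_lifts_iff hq).1 hf
  have h1 : MemSob (q - 1) ((fun _ => 1) + dx f) :=
    (memSob_const (q - 1) 1).add (MemSob.hasDx (by linarith) f.2).2
  have h2 := (h1.inv (by linarith) fun x => (h0 x).ne').mono hsq
  refine ContinuousLinearMap.IsInvertible.of_inverse (g := Sob.mulCLM hs (Sob.mk _ h2)) ?_ ?_ <;>
  · ext w
    refine Subtype.ext (funext fun x => ?_)
    have hx : 1 + dx f x ≠ 0 := (h0 x).ne'
    first
    | exact mul_inv_cancel_left₀ hx (w x)
    | exact inv_mul_cancel_left₀ hx (w x)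

theorem contDiff_mulOneAddDeriv {q s : ℝ} (hq : 3 / 2 < q) (hsq : s ≤ q - 1) (hs : 1 / 2 < s) :
    ContDiff ℝ ∞ (mulOneAddDeriv hq hsq hs) :=
  (Sob.mulCLM hs).contDiff.comp (contDiff_const.add (Sob.derivCLM hq hsq).contDiff)

/-- The chain rule for `v = u ∘ φ` reads `v_x = (1 + f_x) (u_x ∘ φ)`. It exhibits `u_x ∘ φ` as a
smooth function of `(f, v)`. -/
theorem inverse_mulOneAddDeriv_apply {q s : ℝ} (hq : 5 / 2 < q) (hsq : s ≤ q - 1) (hs : 1 / 2 < s)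
    {f : Sob q} (hf : f ∈ lifts q) (v : Sob q) :
    ((mulOneAddDeriv (by linarith) hsq hs f).inverse (Sob.derivCLM (by linarith) hsq v) : S1 → ℝ)
      = (ofLift f).R (dx ((ofLift f).Rinv v)) := by
  have hu := memSob_Rinv hq (by linarith) le_rfl (ofLift f) v.2
  obtain ⟨h1, h2⟩ := hu.hasDx (by linarith)
  have h3 : MemSob s ((ofLift f).R (dx ((ofLift f).Rinv v))) :=
    memSob_R hq hs (by linarith) _ (h2.mono hsq)
  have h4 := (HasDx.comp_lift (isSobLift_ofLift hf).1
    (MemSob.hasDx (by linarith) f.2).1 h1).dx_eq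
  have h5 : ((ofLift f).Rinv v) ∘ (ofLift f).toHomeo = v := R_Rinv (ofLift f) v
  rw [h5] at h4
  have h6 : Sob.derivCLM (by linarith) hsq v
      = mulOneAddDeriv (by linarith) hsq hs f (Sob.mk _ h3) := by
    refine Subtype.ext (funext fun x => ?_)
    exact (congrFun h4 x).trans (mul_comm _ _)
  rw [h6]
  exact congrArg Subtype.val
    ((isInvertible_mulOneAddDeriv hq hsq hs hf).inverse_apply_self (Sob.mk _ h3))

/-- Bijectivity is inherited from `A` by conjugation, since composition with `φ` and `φ⁻¹` preserves
both spaces; the open mapping theorem makes the inverse bounded. -/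
theorem isInvertible_conj {r q : ℝ} (hr : 1 ≤ r) (hq : 3 / 2 + r < q) {p : ℤ → ℂ}
    (A : Sob q ≃L[ℝ] Sob (q - r)) (hA : ∀ u : Sob q, (A u : S1 → ℝ) = op p u)
    {Aφ : SobDiff q → (Sob q →L[ℝ] Sob (q - r))}
    (hAφ : ∀ (φ : SobDiff q) (v : Sob q), (Aφ φ v : S1 → ℝ) = φ.R (op p (φ.Rinv v)))
    (φ : SobDiff q) : (Aφ φ).IsInvertible := by
  have hq' : 5 / 2 < q := by linarith
  have := Sob.completeSpace (s := q) (by linarith)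
  have := Sob.completeSpace (s := q - r) (by linarith)
  have hR : ∀ v : Sob q, MemSob q (φ.Rinv v) := fun v =>
    memSob_Rinv hq' (by linarith) le_rfl φ v.2
  have hinj : Function.Injective (Aφ φ) := by
    intro v w h
    have h1 := congrArg (fun x : Sob (q - r) => φ.Rinv x) h
    simp only [hAφ, Rinv_R] at h1
    have h2 : A (Sob.mk _ (hR v)) = A (Sob.mk _ (hR w)) := by
      refine Sob.ext_coe ?_
      rw [hA, hA, Sob.coe_mk, Sob.coe_mk, h1]
    have h3 : φ.Rinv v = φ.Rinv w := congrArg (fun x : Sob q => (x : S1 → ℝ)) (A.injective h2)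
    refine Sob.ext_coe ?_
    rw [← R_Rinv φ v, h3, R_Rinv]
  have hsurj : Function.Surjective (Aφ φ) := by
    intro w
    have hw := memSob_Rinv hq' (by linarith) (by linarith) φ w.2
    have hv := memSob_R hq' (by linarith) le_rfl φ (A.symm (Sob.mk _ hw)).2
    refine ⟨Sob.mk _ hv, Sob.ext_coe ?_⟩
    rw [hAφ, Sob.coe_mk, Rinv_R, ← hA, A.apply_symm_apply, Sob.coe_mk, R_Rinv]
  exact ⟨ContinuousLinearEquiv.ofBijective (Aφ φ) (LinearMap.ker_eq_bot.2 hinj)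
    (LinearMap.range_eq_top.2 hsurj), by ext; rfl⟩

/-! ### Smoothness of the spray. -/

theorem mainTheorem4 (r q : ℝ) (hr : 1 ≤ r) (hq : 3 / 2 + r < q)
    -- the symbol of a Fourier multiplier of order `r`, mapping real functions to real functions
    (p : ℤ → ℂ) (hp : HasOrder p r) (hreal : ∀ k : ℤ, p (-k) = (starRingEnd ℂ) (p k))
    -- the multiplier induces an isomorphism `A` from `H^q` onto `H^{q-r}`
    (A : Sob q ≃L[ℝ] Sob (q - r)) (hA : ∀ u : Sob q, (A u : S1 → ℝ) = op p u)
    -- `φ ↦ A_φ = R_φ ∘ A ∘ R_{φ⁻¹}` is a smooth map from `D^q` to `L(H^q, H^{q-r})`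
    (Aφ : SobDiff q → (Sob q →L[ℝ] Sob (q - r)))
    (hAφ : ∀ (φ : SobDiff q) (v : Sob q), (Aφ φ v : S1 → ℝ) = φ.R (op p (φ.Rinv v)))
    (hsmooth : SobDiff.Smooth Aφ) :
    -- for `u = R_{φ⁻¹} v` each term of `S u = A⁻¹ {[A,u] u_x - 2 (A u) u_x}` is well defined
    (∀ (φ : SobDiff q) (v : Sob q),
      MemSob q (φ.Rinv v) ∧
      MemSob (q - 1) (dx (φ.Rinv v)) ∧
      MemSob (q - 1) (φ.Rinv v * dx (φ.Rinv v)) ∧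
      MemSob (q - r) (quadTerm p (φ.Rinv v))) ∧
    -- and `(φ, v) ↦ R_φ (S (R_{φ⁻¹} v))` is a smooth map from `D^q × H^q` to `H^q`
    ∃ F : SobDiff q → Sob q → Sob q,
      (∀ (φ : SobDiff q) (v : Sob q), ∃ w : Sob (q - r),
        (w : S1 → ℝ) = quadTerm p (φ.Rinv v) ∧ (F φ v : S1 → ℝ) = φ.R (A.symm w)) ∧
      SobDiff.SmoothProd F := by
  have hq' : 5 / 2 < q := by linarith
  have hs : 1 / 2 < q - r := by linarith
  have hsq : q - r ≤ q - 1 := by linarith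
  have hR : ∀ (φ : SobDiff q) (v : Sob q), MemSob q (φ.Rinv v) := fun φ v =>
    memSob_Rinv hq' (by linarith) le_rfl φ v.2
  set B : Sob q → (Sob q →L[ℝ] Sob (q - r)) := fun f => Aφ (ofLift f) with hB
  let D : Sob q →L[ℝ] Sob (q - r) := Sob.derivCLM (by linarith) hsq
  let M : Sob q → (Sob (q - r) →L[ℝ] Sob (q - r)) := mulOneAddDeriv (by linarith) hsq hs
  let Q : Sob q × Sob q → Sob (q - r) := fun y =>
    fderiv ℝ B y.1 y.2 y.2 + (2 : ℝ) • Sob.mulCLM hs (B y.1 y.2) ((M y.1).inverse (D y.2))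
  have hQ : ∀ f ∈ lifts q, ∀ v, (ofLift f).Rinv (Q (f, v)) = -quadTerm p ((ofLift f).Rinv v) := by
    intro f hf v
    have h1 := Rinv_fderiv_conj_apply hr hq hp hreal hAφ hsmooth hf v
    have h2 : (ofLift f).Rinv (B f v) = op p ((ofLift f).Rinv v) := by
      rw [hB, hAφ, Rinv_R]
    have h3 : (ofLift f).Rinv ((M f).inverse (D v)) = dx ((ofLift f).Rinv v) := by
      rw [inverse_mulOneAddDeriv_apply hq' hsq hs hf v, Rinv_R]
    have h4 : (ofLift f).Rinv (Q (f, v)) = (ofLift f).Rinv (fderiv ℝ B f v v)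
        + 2 * ((ofLift f).Rinv (B f v) * (ofLift f).Rinv ((M f).inverse (D v))) := rfl
    rw [h4, h1, h2, h3, quadTerm]
    ring
  -- The quadratic term is `-R_{φ⁻¹} Q`, and `Q` takes values in `H^{q-r}`; estimating the two terms
  -- of the commutator separately would lose one derivative.
  have hquad : ∀ (φ : SobDiff q) (v : Sob q), MemSob (q - r) (quadTerm p (φ.Rinv v)) := by
    intro φ v
    obtain ⟨f, hf⟩ := φ.mem
    have h1 := hQ f ⟨φ, hf⟩ v
    rw [ofLift_eq hf] at h1
    have h2 := (memSob_Rinv hq' hs (by linarith) φ (Q (f, v)).2).smul (-1)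
    rw [h1] at h2
    simpa using h2
  refine ⟨fun φ v => ⟨hR φ v, ((hR φ v).hasDx (by linarith)).2,
    ((hR φ v).mono (by linarith)).mul (by linarith) ((hR φ v).hasDx (by linarith)).2,
    hquad φ v⟩, ?_⟩
  let S : SobDiff q → Sob q → Sob q := fun φ v => A.symm (Sob.mk _ (hquad φ v))
  let F : SobDiff q → Sob q → Sob q := fun φ v =>
    Sob.mk (φ.R (S φ v)) (memSob_R hq' (by linarith) le_rfl φ (S φ v).2)
  refine ⟨F, fun φ v => ⟨Sob.mk _ (hquad φ v), rfl, rfl⟩, ?_⟩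
  have := Sob.completeSpace (s := q) (by linarith)
  have := Sob.completeSpace hs
  -- Applying `A_φ` to `R_φ (S u)` gives `R_φ` of the quadratic term, that is `-Q`; inverting `A_φ`
  -- leaves a formula free of composition with `φ⁻¹`.
  have hF : ∀ y ∈ lifts q ×ˢ (univ : Set (Sob q)),
      F (ofLift y.1) y.2 = (B y.1).inverse (-Q y) := by
    rintro ⟨f, v⟩ ⟨hf, -⟩
    have h1 : B f (F (ofLift f) v) = -Q (f, v) := by
      refine Sob.ext_coe ?_
      have h2 : -quadTerm p ((ofLift f).Rinv v) = (ofLift f).Rinv (Q (f, v)) := (hQ f hf v).symm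
      have h3 : (A (S (ofLift f) v) : S1 → ℝ) = quadTerm p ((ofLift f).Rinv v) := by
        simp only [S, A.apply_symm_apply, Sob.coe_mk]
      rw [hB, hAφ, Sob.coe_mk, Rinv_R, ← hA, h3, ← neg_neg (quadTerm p _), h2]
      exact congrArg (fun w => -w) (R_Rinv _ _)
    rw [← h1, (isInvertible_conj hr hq A hA hAφ (ofLift f)).inverse_apply_self]
  refine ContDiffOn.congr (fun y hy => ContDiffAt.contDiffWithinAt ?_) hF
  have hy1 : y.1 ∈ lifts q := hy.1
  have hBs : ContDiffAt ℝ ∞ B y.1 := hsmooth.contDiffAt ((isOpen_lifts hq').mem_nhds hy1)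
  have hB1 : ContDiffAt ℝ ∞ (fun y : Sob q × Sob q => B y.1) y := hBs.comp y contDiffAt_fst
  have hB2 : ContDiffAt ℝ ∞ (fun y : Sob q × Sob q => fderiv ℝ B y.1) y :=
    (hBs.fderiv_right (m := ∞) (by simp)).comp y contDiffAt_fst
  have hM : ContDiffAt ℝ ∞ (fun y : Sob q × Sob q => (M y.1).inverse) y :=
    ContDiffAt.comp (g := ContinuousLinearMap.inverse) y
      (isInvertible_mulOneAddDeriv hq' hsq hs hy1).contDiffAt_map_inverse
      ((contDiff_mulOneAddDeriv (by linarith) hsq hs).contDiffAt.comp y contDiffAt_fst)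
  have hBi : ContDiffAt ℝ ∞ (fun y : Sob q × Sob q => (B y.1).inverse) y :=
    ContDiffAt.comp (g := ContinuousLinearMap.inverse) y
      (isInvertible_conj hr hq A hA hAφ (ofLift y.1)).contDiffAt_map_inverse hB1
  have hsnd : ContDiffAt ℝ ∞ (fun y : Sob q × Sob q => y.2) y := contDiffAt_snd
  have hD : ContDiffAt ℝ ∞ (fun y : Sob q × Sob q => D y.2) y := D.contDiff.contDiffAt.comp y hsnd
  have hmul : ContDiffAt ℝ ∞ (fun y : Sob q × Sob q =>
      Sob.mulCLM hs (B y.1 y.2) ((M y.1).inverse (D y.2))) y :=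
    ((Sob.mulCLM hs).contDiff.contDiffAt.comp y (hB1.clm_apply hsnd)).clm_apply
      (hM.clm_apply hD)
  exact hBi.clm_apply (((hB2.clm_apply hsnd).clm_apply hsnd).add (hmul.const_smul (2 : ℝ))).neg
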